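/- For $n_A,n_B,m_A,m_B\ge 1$ let $\mathcal C_{qs}^{(n_A,n_B,m_A,m_B)}\subseteq\mathbb R^{n_An_Bm_Am_B}$ be the set of all families $p(a,b|s,t)$ (with $n_A$, $n_B$ values of $s$, $t$ and $m_A$, $m_B$ values of $a$, $b$) of the form $$p(a,b|s,t)=\langle\psi|P_s^{(a)}\otimes Q_t^{(b)}|\psi\rangle ,$$ where $\psi\in\mathcal H_A\otimes\mathcal H_B$ is a unit vector, $\mathcal H_A,\mathcal H_B$ are separable complex Hilbert spaces, and for each $s$ and each $t$, $\{P_s^{(a)}\}_a$ and $\{Q_t^{(b)}\}_b$ are projective measurements on $\mathcal H_A$ and $\mathcal H_B$ (orthogonal projections summing to the identity). Let $\mathcal C_q^{(n_A,n_B,m_A,m_B)}$ be the set of those $p$ for which $\mathcal H_A,\mathcal H_B$ can be taken finite-dimensional. Let $\mathcal H=\ell^2(\mathbb Z)$ with orthonormal basis $\{|i\rangle: i\in\mathbb Z\}$, let $0<\alpha<1$, and let $$\Psi=\frac1{\sqrt C}\sum_{i\in\mathbb Z}\alpha^{|i|}\,|i\rangle|i\rangle\in\mathcal H\otimes\mathcal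 H,\qquad C=\sum_{i\in\mathbb Z}\alpha^{2|i|}.$$ Let $W_0,W_2:\mathbb C^2\otimes\mathcal H\to\mathcal H$ be the isometries given by $$W_0|0\rangle|j\rangle=\begin{cases}|2j\rangle& j\ge0\\|2j+1\rangle& j<0\end{cases}\qquad W_0|1\rangle|j\rangle=\begin{cases}|2j+1\rangle& j\ge0\\|2j\rangle& j<0\end{cases}$$ $$W_2|0\rangle|j\rangle=\begin{cases}|2j-1\rangle& j>0\\|2j\rangle& j\le0\end{cases}\qquad W_2|1\rangle|j\rangle=\begin{cases}|2j\rangle& j>0\\|2j-1\rangle& j\le0.\end{cases}$$ Let $\sigma_z,\sigma_x$ be the Pauli matrices, let $\theta\in(0,\pi/4)$ and $\mu\in(0,\pi/4)$ be given by $\tan\theta=\alpha$ and $\tan\mu=\sin 2\theta$, and put $\sigma_z^{(\alpha)}=\cos\mu\,\sigma_z+\sin\mu\,\sigma_x$ and $\sigma_x^{(\alpha)}=\cos\mu\,\sigma_z-\sin\mu\,\sigma_x$. For $r\in\{0,2\}$ define on $\mathcal H$ $$A_r=W_r(\sigma_z\otimes I)W_r^\dagger,\quad A_{r+1}=W_r(\sigma_x\otimes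 I)W_r^\dagger,\quad B_r=W_r(\sigma_z^{(\alpha)}\otimes I)W_r^\dagger,\quad B_{r+1}=W_r(\sigma_x^{(\alpha)}\otimes I)W_r^\dagger .$$ For $M\in\{A_s,B_t\}$ and $a\in\{0,1\}$ let $M^{(a)}$ be the orthogonal projection onto the eigenspace of $M$ with eigenvalue $(-1)^a$, and let $$p(a,b|s,t)=\langle\Psi|A_s^{(a)}\otimes B_t^{(b)}|\Psi\rangle,\qquad s,t\in\{0,1,2,3\},\ a,b\in\{0,1\}.$$ Then, for every $\alpha\in(0,1)$, $\Psi$ is a unit vector, $\{A_s^{(a)}\}_a$ and $\{B_t^{(b)}\}_b$ are projective measurements (so that these data realize $p$ as above), and $$p\in\mathcal C_{qs}^{(4,4,2,2)},\qquad p\notin\mathcal C_q^{(4,4,2,2)}.$$ In particular $\mathcal C_q^{(4,4,2,2)}\neq\mathcal C_{qs}^{(4,4,2,2)}$. -/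

import Mathlib

open scoped TensorProduct

noncomputable section

namespace QCorr

/-! ### Hilbert tensor products -/

/-- The Hilbert space tensor product `H ⊗ K`: the completion of the algebraic tensor product for
the inner product with `⟪x ⊗ y, x' ⊗ y'⟫ = ⟪x, x'⟫ ⟪y, y'⟫`. -/
abbrev HTensor (H K : Type*) [NormedAddCommGroup H] [InnerProductSpace ℂ H]
    [NormedAddCommGroup K] [InnerProductSpace ℂ K] : Type _ :=
  UniformSpace.Completion (H ⊗[ℂ] K)

section Tensor

variable {H K : Type*} [NormedAddCommGroup H] [InnerProductSpace ℂ H]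
    [NormedAddCommGroup K] [InnerProductSpace ℂ K]

/-- The product vector `x ⊗ y` in the Hilbert tensor product. -/
def htmul (x : H) (y : K) : HTensor H K := ((x ⊗ₜ[ℂ] y : H ⊗[ℂ] K) : HTensor H K)

/-- The bounded operator `S ⊗ T` on the Hilbert tensor product. -/
def opTensor (S : H →L[ℂ] H) (T : K →L[ℂ] K) : HTensor H K →L[ℂ] HTensor H K :=
  (TensorProduct.mapL S T).completion

theorem opTensor_htmul (S : H →L[ℂ] H) (T : K →L[ℂ] K) (x : H) (y : K) :
    opTensor S T (htmul x y) = htmul (S x) (T y) := by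
  simp [opTensor, htmul]

theorem inner_htmul (x x' : H) (y y' : K) :
    inner ℂ (htmul x y) (htmul x' y') = inner ℂ x x' * inner ℂ y y' := by
  simp [htmul]

end Tensor

/-! ### Correlations and the sets `C_q`, `C_qs` -/

/-- Families `p(a, b | s, t)` of real numbers, written `p a b s t`, with `nA`, `nB` inputs `s`, `t`
and `mA`, `mB` outputs `a`, `b`. -/
abbrev Correlation (nA nB mA mB : ℕ) : Type :=
  Fin mA → Fin mB → Fin nA → Fin nB → ℝ

/-- A projective measurement: orthogonal projections that sum to the identity (they are then
automatically pairwise orthogonal). -/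
def IsProjectiveMeasurement {H : Type*} [NormedAddCommGroup H] [InnerProductSpace ℂ H]
    [CompleteSpace H] {m : ℕ} (P : Fin m → H →L[ℂ] H) : Prop :=
  (∀ a, IsStarProjection (P a)) ∧ ∑ a, P a = 1

/-- The unit vector `ψ` and the projective measurements `P s`, `Q t` generate `p`, that is,
`p(a, b | s, t) = ⟨ψ| P_s^(a) ⊗ Q_t^(b) |ψ⟩`. -/
def Generates {HA HB : Type*} [NormedAddCommGroup HA] [InnerProductSpace ℂ HA] [CompleteSpace HA]
    [NormedAddCommGroup HB] [InnerProductSpace ℂ HB] [CompleteSpace HB] {nA nB mA mB : ℕ}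
    (ψ : HTensor HA HB) (P : Fin nA → Fin mA → HA →L[ℂ] HA) (Q : Fin nB → Fin mB → HB →L[ℂ] HB)
    (p : Correlation nA nB mA mB) : Prop :=
  ‖ψ‖ = 1 ∧ (∀ s, IsProjectiveMeasurement (P s)) ∧ (∀ t, IsProjectiveMeasurement (Q t)) ∧
    ∀ a b s t, (p a b s t : ℂ) = inner ℂ ψ (opTensor (P s a) (Q t b) ψ)

/-- `C_qs`: correlations generated on separable Hilbert spaces. -/
def Cqs (nA nB mA mB : ℕ) : Set (Correlation nA nB mA mB) :=
  {p | ∃ (HA : Type) (_ : NormedAddCommGroup HA) (_ : InnerProductSpace ℂ HA)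
      (_ : CompleteSpace HA) (_ : TopologicalSpace.SeparableSpace HA)
      (HB : Type) (_ : NormedAddCommGroup HB) (_ : InnerProductSpace ℂ HB)
      (_ : CompleteSpace HB) (_ : TopologicalSpace.SeparableSpace HB)
      (ψ : HTensor HA HB) (P : Fin nA → Fin mA → HA →L[ℂ] HA) (Q : Fin nB → Fin mB → HB →L[ℂ] HB),
      Generates ψ P Q p}

/-- `C_q`: correlations generated on finite-dimensional Hilbert spaces. (Completeness is automatic
there; it is listed only to make the adjoint available.) -/
def Cq (nA nB mA mB : ℕ) : Set (Correlation nA nB mA mB) :=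
  {p | ∃ (HA : Type) (_ : NormedAddCommGroup HA) (_ : InnerProductSpace ℂ HA)
      (_ : CompleteSpace HA) (_ : FiniteDimensional ℂ HA)
      (HB : Type) (_ : NormedAddCommGroup HB) (_ : InnerProductSpace ℂ HB)
      (_ : CompleteSpace HB) (_ : FiniteDimensional ℂ HB)
      (ψ : HTensor HA HB) (P : Fin nA → Fin mA → HA →L[ℂ] HA) (Q : Fin nB → Fin mB → HB →L[ℂ] HB),
      Generates ψ P Q p}

/-! ### The space `ℓ²(ℤ)` and the state `Ψ` -/

/-- The Hilbert space `ℓ²(ℤ)`. -/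
abbrev HZ : Type := lp (fun _ : ℤ => ℂ) 2

/-- The basis vector `|i⟩` of `ℓ²(ℤ)`. -/
def zKet (i : ℤ) : HZ := lp.single 2 i (1 : ℂ)

/-- The normalization factor `C = ∑ α^(2|i|)`. -/
def normC (α : ℝ) : ℝ := ∑' i : ℤ, α ^ (2 * i.natAbs)

/-- The state `Ψ = C^(-1/2) ∑ α^|i| |i⟩|i⟩`. -/
def Psi (α : ℝ) : HTensor HZ HZ :=
  (((1 / √(normC α) : ℝ)) : ℂ) • ∑' i : ℤ, ((α ^ i.natAbs : ℝ) : ℂ) • htmul (zKet i) (zKet i)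

/-! ### The isometries `W₀`, `W₂` from `ℂ² ⊗ ℓ²(ℤ)` to `ℓ²(ℤ)` -/

/-- The space `ℂ²`. -/
abbrev Qubit : Type := EuclideanSpace ℂ (Fin 2)

/-- The computational basis vector `|a⟩` of `ℂ²`. -/
def qKet (a : Fin 2) : Qubit := EuclideanSpace.single a (1 : ℂ)

theorem orthonormal_zKet : Orthonormal ℂ zKet := by
  rw [orthonormal_iff_ite]
  intro i j
  simp only [zKet]
  rw [lp.inner_single_left]
  simp [lp.single_apply, Pi.single_apply]

theorem orthonormal_qz :
    Orthonormal ℂ (fun x : Fin 2 × ℤ => htmul (qKet x.1) (zKet x.2)) := by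
  rw [orthonormal_iff_ite]
  rintro ⟨a, i⟩ ⟨b, j⟩
  simp only [inner_htmul, orthonormal_iff_ite.1 orthonormal_zKet i j]
  rw [show inner ℂ (qKet a) (qKet b) = if a = b then (1 : ℂ) else 0 from
    orthonormal_iff_ite.1 (EuclideanSpace.orthonormal_single (𝕜 := ℂ) (ι := Fin 2)) a b]
  simp only [Prod.mk.injEq]
  split_ifs <;> simp_all

theorem dense_qz :
    ⊤ ≤ (Submodule.span ℂ
      (Set.range fun x : Fin 2 × ℤ => htmul (qKet x.1) (zKet x.2))).topologicalClosure := by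
  set S := (Submodule.span ℂ
      (Set.range fun x : Fin 2 × ℤ => htmul (qKet x.1) (zKet x.2))).topologicalClosure with hS
  have hcl : IsClosed (S : Set (HTensor Qubit HZ)) := Submodule.isClosed_topologicalClosure _
  have h1 : ∀ (a : Fin 2) (y : HZ), htmul (qKet a) y ∈ S := by
    intro a y
    let f : HZ →L[ℂ] HTensor Qubit HZ :=
      UniformSpace.Completion.toComplL ∘L TensorProduct.mkL ℂ Qubit HZ (qKet a)
    have hsum := f.hasSum (lp.hasSum_single (p := 2) (by simp) y)
    refine hcl.mem_of_tendsto hsum (Filter.Eventually.of_forall fun t => ?_)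
    refine S.sum_mem fun i _ => ?_
    have : (lp.single 2 i (y i) : HZ) = y i • zKet i := by
      rw [zKet, ← lp.single_smul, smul_eq_mul, mul_one]
    rw [this, map_smul]
    exact S.smul_mem _ (Submodule.le_topologicalClosure _ (Submodule.subset_span ⟨(a, i), rfl⟩))
  intro z hz
  clear hz
  induction z using UniformSpace.Completion.induction_on with
  | hp => exact hcl
  | ih t =>
    induction t using TensorProduct.induction_on with
    | zero => exact S.zero_mem
    | add x y hx hy => rw [UniformSpace.Completion.coe_add]; exact S.add_mem hx hy
    | tmul x y =>
      have hx : x = ∑ a, x a • qKet a := by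
        ext b; simp [qKet, Fin.sum_univ_two]; fin_cases b <;> simp
      have : ((x ⊗ₜ[ℂ] y : Qubit ⊗[ℂ] HZ) : HTensor Qubit HZ)
          = ∑ a, x a • htmul (qKet a) y := by
        conv_lhs => rw [hx]
        simp [Fin.sum_univ_two, TensorProduct.add_tmul, ← TensorProduct.smul_tmul', htmul,
          UniformSpace.Completion.coe_add, UniformSpace.Completion.coe_smul]
      rw [this]
      exact S.sum_mem fun a _ => S.smul_mem _ (h1 a y)

/-- The Hilbert basis `|a⟩|i⟩` of `ℂ² ⊗ ℓ²(ℤ)`. -/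
def qzBasis : HilbertBasis (Fin 2 × ℤ) ℂ (HTensor Qubit HZ) :=
  HilbertBasis.mk orthonormal_qz dense_qz

/-- The isometry `ℂ² ⊗ ℓ²(ℤ) → ℓ²(ℤ)` with `|a⟩|j⟩ ↦ |w a j⟩`, for an injective `w`. -/
def pairIsometry (w : Fin 2 × ℤ → ℤ) (hw : Function.Injective w) : HTensor Qubit HZ →ₗᵢ[ℂ] HZ :=
  ((orthonormal_zKet.comp w hw).orthogonalFamily.linearIsometry).comp
    qzBasis.repr.toLinearIsometry

theorem pairIsometry_apply (w : Fin 2 × ℤ → ℤ) (hw : Function.Injective w) (a : Fin 2) (j : ℤ) :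
    pairIsometry w hw (htmul (qKet a) (zKet j)) = zKet (w (a, j)) := by
  have h : htmul (qKet a) (zKet j) = qzBasis (a, j) := by simp [qzBasis]
  rw [h]
  simp [pairIsometry, HilbertBasis.repr_self, OrthogonalFamily.linearIsometry_apply_single]

/-- The pairing behind `W₀`. -/
def w0 (x : Fin 2 × ℤ) : ℤ :=
  if x.1 = 0 then (if 0 ≤ x.2 then 2 * x.2 else 2 * x.2 + 1)
  else (if 0 ≤ x.2 then 2 * x.2 + 1 else 2 * x.2)

/-- The pairing behind `W₂`. -/
def w2 (x : Fin 2 × ℤ) : ℤ :=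
  if x.1 = 0 then (if 0 < x.2 then 2 * x.2 - 1 else 2 * x.2)
  else (if 0 < x.2 then 2 * x.2 else 2 * x.2 - 1)

theorem w0_injective : Function.Injective w0 := by
  rintro ⟨a, i⟩ ⟨b, j⟩ h
  fin_cases a <;> fin_cases b <;> simp [w0] at h ⊢ <;> split_ifs at h <;> omega

theorem w2_injective : Function.Injective w2 := by
  rintro ⟨a, i⟩ ⟨b, j⟩ h
  fin_cases a <;> fin_cases b <;> simp [w2] at h ⊢ <;> split_ifs at h <;> omega

/-- The isometry `W₀`, pairing `{2j, 2j+1}`. -/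
def W0 : HTensor Qubit HZ →ₗᵢ[ℂ] HZ := pairIsometry w0 w0_injective

/-- The isometry `W₂`, pairing `{2j-1, 2j}`. -/
def W2 : HTensor Qubit HZ →ₗᵢ[ℂ] HZ := pairIsometry w2 w2_injective

/-! ### The observables and the correlation -/

/-- The Pauli matrix `σ_z`. -/
def sigmaZ : Matrix (Fin 2) (Fin 2) ℂ := !![1, 0; 0, -1]

/-- The Pauli matrix `σ_x`. -/
def sigmaX : Matrix (Fin 2) (Fin 2) ℂ := !![0, 1; 1, 0]

/-- The angle `μ` with `tan μ = sin (2θ)`, where `tan θ = α`. -/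
def mu (α : ℝ) : ℝ := Real.arctan (Real.sin (2 * Real.arctan α))

/-- `σ_z^(α) = cos μ σ_z + sin μ σ_x`. -/
def sigmaZα (α : ℝ) : Matrix (Fin 2) (Fin 2) ℂ :=
  (Real.cos (mu α) : ℂ) • sigmaZ + (Real.sin (mu α) : ℂ) • sigmaX

/-- `σ_x^(α) = cos μ σ_z - sin μ σ_x`. -/
def sigmaXα (α : ℝ) : Matrix (Fin 2) (Fin 2) ℂ :=
  (Real.cos (mu α) : ℂ) • sigmaZ - (Real.sin (mu α) : ℂ) • sigmaX

/-- `W (σ ⊗ I) W†`. -/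
def conjObs (W : HTensor Qubit HZ →ₗᵢ[ℂ] HZ) (σ : Matrix (Fin 2) (Fin 2) ℂ) : HZ →L[ℂ] HZ :=
  W.toContinuousLinearMap ∘L opTensor (Matrix.toEuclideanCLM (𝕜 := ℂ) σ) (1 : HZ →L[ℂ] HZ) ∘L
    ContinuousLinearMap.adjoint W.toContinuousLinearMap

/-- Alice's observables `A₀, A₁, A₂, A₃`. -/
def obsA : Fin 4 → HZ →L[ℂ] HZ :=
  ![conjObs W0 sigmaZ, conjObs W0 sigmaX, conjObs W2 sigmaZ, conjObs W2 sigmaX]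

/-- Bob's observables `B₀, B₁, B₂, B₃`. -/
def obsB (α : ℝ) : Fin 4 → HZ →L[ℂ] HZ :=
  ![conjObs W0 (sigmaZα α), conjObs W0 (sigmaXα α), conjObs W2 (sigmaZα α), conjObs W2 (sigmaXα α)]

instance eigenspace_complete (M : HZ →L[ℂ] HZ) (c : ℂ) :
    CompleteSpace (Module.End.eigenspace (M : HZ →ₗ[ℂ] HZ) c) := by
  have h : IsClosed (Module.End.eigenspace (M : HZ →ₗ[ℂ] HZ) c : Set HZ) := by
    have : (Module.End.eigenspace (M : HZ →ₗ[ℂ] HZ) c : Set HZ) = {x | M x = c • x} := by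
      ext x; simp
    rw [this]
    exact isClosed_eq M.continuous (continuous_const_smul c)
  exact h.completeSpace_coe

/-- `M^(a)`: the orthogonal projection onto the eigenspace of `M` with eigenvalue `(-1)^a`. -/
def outcomeProj (M : HZ →L[ℂ] HZ) (a : Fin 2) : HZ →L[ℂ] HZ :=
  (Module.End.eigenspace (M : HZ →ₗ[ℂ] HZ) ((-1 : ℂ) ^ (a : ℕ))).starProjection

/-- The correlation `p(a, b | s, t) = ⟨Ψ| A_s^(a) ⊗ B_t^(b) |Ψ⟩` (the inner product is real). -/
def corr (α : ℝ) : Correlation 4 4 2 2 := fun a b s t =>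
  (inner ℂ (Psi α)
    (opTensor (outcomeProj (obsA s) a) (outcomeProj (obsB α t) b) (Psi α))).re

end QCorr

end

/-! Each of `W0`, `W2` pairs up the integers so that the second member of a pair is one step further
from 0. Through either pairing `Psi α` therefore looks like cos θ |00⟩ + sin θ |11⟩ tensored with a
residual state, and the questions {0,1} and {2,3} each form an optimal strategy for a tilted CHSH
inequality. Membership in `Cqs` is by construction (`generates_corr`).

For the exclusion from `Cq`, take any strategy for `corr α` with Bob's space finite-dimensional;
Alice's may be arbitrary. Write k = cos 2θ and c = cos μ. Saturation of tilted CHSH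
(`tilted_chsh_rigidity`) gives, for r = 0, 2, that (B_r + B_{r+1})ψ = 2c A_r ψ and that (B_r -
B_{r+1})(1 - A_r)ψ = 2c(1 - k) A_{r+1}(1 + A_r)ψ. Let U be the space of all (1 ⊗ T)ψ, which is
finite-dimensional, and let Π_r = (1 - A_r)/2. The first relation makes U invariant under Π_r; by
the second, A_{r+1} embeds (1 - Π_r)U into Π_r U, so Π_r U has at least half the dimension of U
(`finrank_bobOrbit_le`).

No integer is a second member in both pairings. This is visible in the cross correlations and forces
Π_0 Π_2 = Π_2 Π_0 = 0 on U (`sub_apply_sub_apply_eq_zero`). Two mutually annihilating projections of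
at least half rank must sum to the identity on U (`add_apply_eq_self_of_finrank_le`). Taking
expectations in ψ gives 1 - k = 1, against k > 0. In the infinite model there is no conflict: there
Π_0 + Π_2 misses exactly the basis vector at 0, a Hilbert hotel. -/

noncomputable section

namespace QCorr

/-! ### Operators on the Hilbert tensor product. -/

section TensorAlgebra

variable {H K : Type*} [NormedAddCommGroup H] [InnerProductSpace ℂ H]
    [NormedAddCommGroup K] [InnerProductSpace ℂ K]

theorem htmul_add_left (x x' : H) (y : K) : htmul (x + x') y = htmul x y + htmul x' y := by
  simp [htmul, TensorProduct.add_tmul, UniformSpace.Completion.coe_add]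

theorem htmul_add_right (x : H) (y y' : K) : htmul x (y + y') = htmul x y + htmul x y' := by
  simp [htmul, TensorProduct.tmul_add, UniformSpace.Completion.coe_add]

theorem htmul_smul_left (c : ℂ) (x : H) (y : K) : htmul (c • x) y = c • htmul x y := by
  simp [htmul, ← TensorProduct.smul_tmul', UniformSpace.Completion.coe_smul]

theorem htmul_smul_right (c : ℂ) (x : H) (y : K) : htmul x (c • y) = c • htmul x y := by
  simp [htmul, TensorProduct.tmul_smul, UniformSpace.Completion.coe_smul]

/-- A continuous linear map on the Hilbert tensor product is determined by its values on product
vectors. -/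
theorem clm_ext_htmul {E : Type*} [NormedAddCommGroup E] [NormedSpace ℂ E]
    {f g : HTensor H K →L[ℂ] E} (h : ∀ x y, f (htmul x y) = g (htmul x y)) : f = g := by
  ext z
  induction z using UniformSpace.Completion.induction_on with
  | hp => exact isClosed_eq f.continuous g.continuous
  | ih t =>
    induction t using TensorProduct.induction_on with
    | zero => exact (map_zero f).trans (map_zero g).symm
    | add x y hx hy => rw [UniformSpace.Completion.coe_add, map_add, map_add, hx, hy]
    | tmul x y => exact h x y

theorem opTensor_one_one : opTensor (1 : H →L[ℂ] H) (1 : K →L[ℂ] K) = 1 :=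
  clm_ext_htmul fun x y => by simp [opTensor_htmul]

theorem opTensor_mul (S S' : H →L[ℂ] H) (T T' : K →L[ℂ] K) :
    opTensor S T * opTensor S' T' = opTensor (S * S') (T * T') :=
  clm_ext_htmul fun x y => by simp [opTensor_htmul]

theorem opTensor_add_left (S S' : H →L[ℂ] H) (T : K →L[ℂ] K) :
    opTensor (S + S') T = opTensor S T + opTensor S' T :=
  clm_ext_htmul fun x y => by simp [opTensor_htmul, htmul_add_left]

theorem opTensor_add_right (S : H →L[ℂ] H) (T T' : K →L[ℂ] K) :
    opTensor S (T + T') = opTensor S T + opTensor S T' :=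
  clm_ext_htmul fun x y => by simp [opTensor_htmul, htmul_add_right]

theorem opTensor_smul_left (c : ℂ) (S : H →L[ℂ] H) (T : K →L[ℂ] K) :
    opTensor (c • S) T = c • opTensor S T :=
  clm_ext_htmul fun x y => by simp [opTensor_htmul, htmul_smul_left]

theorem opTensor_smul_right (c : ℂ) (S : H →L[ℂ] H) (T : K →L[ℂ] K) :
    opTensor S (c • T) = c • opTensor S T :=
  clm_ext_htmul fun x y => by simp [opTensor_htmul, htmul_smul_right]

theorem opTensor_sub_left (S S' : H →L[ℂ] H) (T : K →L[ℂ] K) :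
    opTensor (S - S') T = opTensor S T - opTensor S' T := by
  rw [eq_sub_iff_add_eq, ← opTensor_add_left, sub_add_cancel]

theorem opTensor_sub_right (S : H →L[ℂ] H) (T T' : K →L[ℂ] K) :
    opTensor S (T - T') = opTensor S T - opTensor S T' := by
  rw [eq_sub_iff_add_eq, ← opTensor_add_right, sub_add_cancel]

theorem opTensor_one_mul_one (S : H →L[ℂ] H) (T : K →L[ℂ] K) :
    opTensor S 1 * opTensor 1 T = opTensor S T := by
  rw [opTensor_mul, mul_one, one_mul]

theorem one_opTensor_mul_opTensor_one (S : H →L[ℂ] H) (T : K →L[ℂ] K) :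
    opTensor 1 T * opTensor S 1 = opTensor S 1 * opTensor 1 T := by
  rw [opTensor_mul, opTensor_mul, mul_one, one_mul, mul_one, one_mul]

theorem opTensor_one_apply_comm (S : H →L[ℂ] H) (T : K →L[ℂ] K) (x : HTensor H K) :
    opTensor S 1 (opTensor 1 T x) = opTensor 1 T (opTensor S 1 x) := by
  rw [← mul_apply_eq_comp, ← one_opTensor_mul_opTensor_one, mul_apply_eq_comp]

theorem opTensor_one_apply_self {S : H →L[ℂ] H} (hS : S * S = 1) (x : HTensor H K) :
    opTensor S 1 (opTensor S 1 x) = x := by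
  rw [← mul_apply_eq_comp, opTensor_mul, hS, one_mul, opTensor_one_one]; rfl

/-- Both sides are continuous in each vector, so density reduces the claim to product vectors, where
the inner product factors. -/
theorem inner_opTensor [CompleteSpace H] [CompleteSpace K] (S : H →L[ℂ] H) (T : K →L[ℂ] K)
    (x y : HTensor H K) :
    inner ℂ (opTensor S T x) y
      = inner ℂ x (opTensor (ContinuousLinearMap.adjoint S) (ContinuousLinearMap.adjoint T) y) := by
  rw [← ContinuousLinearMap.adjoint_inner_right]
  congr 2
  refine clm_ext_htmul fun u v => ?_
  refine ext_inner_left ℂ fun z => ?_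
  rw [ContinuousLinearMap.adjoint_inner_right, opTensor_htmul]
  induction z using UniformSpace.Completion.induction_on with
  | hp => exact isClosed_eq (by fun_prop) (by fun_prop)
  | ih t =>
    induction t using TensorProduct.induction_on with
    | zero =>
      change inner ℂ (opTensor S T 0) _ = inner ℂ 0 _
      rw [map_zero, inner_zero_left, inner_zero_left]
    | add x y hx hy =>
      rw [UniformSpace.Completion.coe_add, map_add, inner_add_left, inner_add_left, hx, hy]
    | tmul x y =>
      change inner ℂ (opTensor S T (htmul x y)) _ = inner ℂ (htmul x y) _
      simp only [opTensor_htmul, inner_htmul, ContinuousLinearMap.adjoint_inner_right]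

theorem isSelfAdjoint_opTensor [CompleteSpace H] [CompleteSpace K] {S : H →L[ℂ] H} {T : K →L[ℂ] K}
    (hS : IsSelfAdjoint S) (hT : IsSelfAdjoint T) : IsSelfAdjoint (opTensor S T) := by
  rw [ContinuousLinearMap.isSelfAdjoint_iff_isSymmetric]
  intro x y
  have := inner_opTensor S T x y
  rwa [hS.adjoint_eq, hT.adjoint_eq] at this

theorem isStarProjection_opTensor [CompleteSpace H] [CompleteSpace K] {S : H →L[ℂ] H}
    {T : K →L[ℂ] K} (hS : IsStarProjection S) (hT : IsStarProjection T) :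
    IsStarProjection (opTensor S T) :=
  ⟨by rw [IsIdempotentElem, opTensor_mul, hS.isIdempotentElem.eq, hT.isIdempotentElem.eq],
    isSelfAdjoint_opTensor hS.isSelfAdjoint hT.isSelfAdjoint⟩

end TensorAlgebra

/-! ### Expectations of ±1 observables as linear functions of the correlation. -/

section Observables

variable {H : Type*} [NormedAddCommGroup H] [InnerProductSpace ℂ H] [CompleteSpace H]

/-- The `±1`-valued observable of a two-outcome measurement. -/
def observable (P : Fin 2 → H →L[ℂ] H) : H →L[ℂ] H := P 0 - P 1

theorem IsProjectiveMeasurement.isSelfAdjoint_observable {P : Fin 2 → H →L[ℂ] H}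
    (hP : IsProjectiveMeasurement P) : IsSelfAdjoint (observable P) :=
  (hP.1 0).isSelfAdjoint.sub (hP.1 1).isSelfAdjoint

theorem IsProjectiveMeasurement.observable_mul_self {P : Fin 2 → H →L[ℂ] H}
    (hP : IsProjectiveMeasurement P) : observable P * observable P = 1 := by
  have h1 : P 1 = 1 - P 0 := by
    rw [← hP.2, Fin.sum_univ_two]; abel
  have h2 := (hP.1 0).isIdempotentElem.eq
  rw [observable, h1, show P 0 - (1 - P 0) = 2 * P 0 - 1 by noncomm_ring]
  have : (2 * P 0 - 1) * (2 * P 0 - 1) = 4 * (P 0 * P 0) - 4 * P 0 + 1 := by noncomm_ring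
  rw [this, h2]; abel

variable {K : Type*} [NormedAddCommGroup K] [InnerProductSpace ℂ K] [CompleteSpace K]

theorem Generates.inner_observables {nA nB : ℕ} {ψ : HTensor H K} {P : Fin nA → Fin 2 → H →L[ℂ] H}
    {Q : Fin nB → Fin 2 → K →L[ℂ] K} {p : Correlation nA nB 2 2} (h : Generates ψ P Q p)
    (s : Fin nA) (t : Fin nB) :
    inner ℂ ψ (opTensor (observable (P s)) (observable (Q t)) ψ)
      = ((p 0 0 s t - p 0 1 s t - p 1 0 s t + p 1 1 s t : ℝ) : ℂ) := by
  push_cast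
  simp only [h.2.2.2, observable, opTensor_sub_left, opTensor_sub_right,
    sub_apply, inner_sub_right]
  ring

/-- Summing over Bob's outcomes turns his operators into the identity, so `t` is a dummy question.
-/
theorem Generates.inner_observable_left {nA nB : ℕ} {ψ : HTensor H K}
    {P : Fin nA → Fin 2 → H →L[ℂ] H}
    {Q : Fin nB → Fin 2 → K →L[ℂ] K} {p : Correlation nA nB 2 2} (h : Generates ψ P Q p)
    (s : Fin nA) (t : Fin nB) :
    inner ℂ ψ (opTensor (observable (P s)) 1 ψ)
      = ((p 0 0 s t + p 0 1 s t - p 1 0 s t - p 1 1 s t : ℝ) : ℂ) := by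
  push_cast
  rw [← (h.2.2.1 t).2]
  simp only [h.2.2.2, observable, opTensor_sub_left, opTensor_add_right, Fin.sum_univ_two,
    sub_apply, add_apply, inner_sub_right, inner_add_right]
  ring

theorem Generates.inner_observable_right {nA nB : ℕ} {ψ : HTensor H K}
    {P : Fin nA → Fin 2 → H →L[ℂ] H}
    {Q : Fin nB → Fin 2 → K →L[ℂ] K} {p : Correlation nA nB 2 2} (h : Generates ψ P Q p)
    (s : Fin nA) (t : Fin nB) :
    inner ℂ ψ (opTensor 1 (observable (Q t)) ψ)
      = ((p 0 0 s t - p 0 1 s t + p 1 0 s t - p 1 1 s t : ℝ) : ℂ) := by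
  push_cast
  rw [← (h.2.1 s).2]
  simp only [h.2.2.2, observable, opTensor_sub_right, opTensor_add_left, Fin.sum_univ_two,
    sub_apply, add_apply, inner_sub_right, inner_add_right]
  ring

end Observables

/-! ### Rigidity of the tilted CHSH inequality. -/

section TiltedCHSH

variable {H : Type*} [NormedAddCommGroup H] [InnerProductSpace ℂ H] [CompleteSpace H]

theorem norm_sq_apply_of_isSelfAdjoint {S : H →L[ℂ] H} (hS : IsSelfAdjoint S) (x : H) :
    inner ℂ x ((S * S) x) = ((‖S x‖ ^ 2 : ℝ) : ℂ) := by
  have := (ContinuousLinearMap.isSelfAdjoint_iff_isSymmetric.1 hS) x (S x)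
  simp only [ContinuousLinearMap.coe_coe] at this
  rw [mul_apply_eq_comp, ← this, inner_self_eq_norm_sq_to_K]
  norm_cast

/-- The sum-of-squares identity behind the maximal quantum value of the tilted CHSH operator. -/
theorem tilted_chsh_sq_add_sq {R : Type*} [Ring R] [Algebra ℂ R] (β : ℂ) {A₀ A₁ B₀ B₁ : R}
    (hA₀ : A₀ * A₀ = 1) (hA₁ : A₁ * A₁ = 1) (hB₀ : B₀ * B₀ = 1) (hB₁ : B₁ * B₁ = 1)
    (h00 : B₀ * A₀ = A₀ * B₀) (h01 : B₀ * A₁ = A₁ * B₀)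
    (h10 : B₁ * A₀ = A₀ * B₁) (h11 : B₁ * A₁ = A₁ * B₁) :
    (β • A₀ + A₀ * (B₀ + B₁) + A₁ * (B₀ - B₁)) * (β • A₀ + A₀ * (B₀ + B₁) + A₁ * (B₀ - B₁))
      + (β • A₁ - A₀ * (B₀ - B₁) - A₁ * (B₀ + B₁)) * (β • A₁ - A₀ * (B₀ - B₁) - A₁ * (B₀ + B₁))
      = (2 * (β * β) + 8) • (1 : R) := by
  have k00 (x : R) : B₀ * (A₀ * x) = A₀ * (B₀ * x) := by rw [← mul_assoc, h00, mul_assoc]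
  have k01 (x : R) : B₀ * (A₁ * x) = A₁ * (B₀ * x) := by rw [← mul_assoc, h01, mul_assoc]
  have k10 (x : R) : B₁ * (A₀ * x) = A₀ * (B₁ * x) := by rw [← mul_assoc, h10, mul_assoc]
  have k11 (x : R) : B₁ * (A₁ * x) = A₁ * (B₁ * x) := by rw [← mul_assoc, h11, mul_assoc]
  have kA₀ (x : R) : A₀ * (A₀ * x) = x := by rw [← mul_assoc, hA₀, one_mul]
  have kA₁ (x : R) : A₁ * (A₁ * x) = x := by rw [← mul_assoc, hA₁, one_mul]
  simp only [mul_add, add_mul, mul_sub, sub_mul, smul_mul_assoc, mul_smul_comm, mul_assoc, k00, k01,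
    k10, k11, kA₀, kA₁, hA₀, hA₁, hB₀, hB₁, h00, h01, h10, h11, mul_one]
  module

/-- Rigidity for the tilted CHSH correlation: Alice's and Bob's observables act on the state as
they do on `cos θ |00⟩ + sin θ |11⟩`, where `k = cos 2θ`, `s = sin 2θ` and `c = cos μ`. -/
theorem tilted_chsh_rigidity {A₀ A₁ B₀ B₁ : H →L[ℂ] H} {ψ : H} {c k s : ℝ} (hψ : ‖ψ‖ = 1)
    (sA₀ : IsSelfAdjoint A₀) (sA₁ : IsSelfAdjoint A₁) (sB₀ : IsSelfAdjoint B₀)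
    (sB₁ : IsSelfAdjoint B₁)
    (hA₀ : A₀ * A₀ = 1) (hA₁ : A₁ * A₁ = 1) (hB₀ : B₀ * B₀ = 1) (hB₁ : B₁ * B₁ = 1)
    (h00 : B₀ * A₀ = A₀ * B₀) (h01 : B₀ * A₁ = A₁ * B₀)
    (h10 : B₁ * A₀ = A₀ * B₁) (h11 : B₁ * A₁ = A₁ * B₁)
    (hsk : s ^ 2 + k ^ 2 = 1) (hc : c ^ 2 * (1 + s ^ 2) = 1)
    (eA : inner ℂ ψ (A₀ ψ) = k) (eB : inner ℂ ψ ((B₀ + B₁) ψ) = (2 * c * k : ℝ))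
    (e0 : inner ℂ ψ ((A₀ * (B₀ + B₁)) ψ) = (2 * c : ℝ))
    (e1 : inner ℂ ψ ((A₁ * (B₀ - B₁)) ψ) = (2 * c * s ^ 2 : ℝ)) :
    (B₀ + B₁) ψ = ((2 * c : ℝ) : ℂ) • A₀ ψ ∧
      (B₀ - B₁) (ψ - A₀ ψ) = ((2 * c * (1 - k) : ℝ) : ℂ) • A₁ (ψ + A₀ ψ) := by
  have hψ' : inner ℂ ψ ψ = (1 : ℂ) := by rw [inner_self_eq_norm_sq_to_K, hψ]; simp
  -- The tilt for which 2β² + 8 = (4c)², so that the given expectations attain the maximal value 4c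
  -- of `Be`.
  obtain ⟨β, hβ⟩ : ∃ β : ℝ, β = 2 * c * k := ⟨_, rfl⟩
  have hsq := tilted_chsh_sq_add_sq (β : ℂ) hA₀ hA₁ hB₀ hB₁ h00 h01 h10 h11
  obtain ⟨Be, hBe⟩ : ∃ X, X = (β : ℂ) • A₀ + A₀ * (B₀ + B₁) + A₁ * (B₀ - B₁) := ⟨_, rfl⟩
  obtain ⟨T, hT⟩ : ∃ X, X = (β : ℂ) • A₁ - A₀ * (B₀ - B₁) - A₁ * (B₀ + B₁) := ⟨_, rfl⟩
  rw [← hBe, ← hT] at hsq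
  have sβ : IsSelfAdjoint (β : ℂ) := by simp [isSelfAdjoint_iff]
  have comm_sa {X Y : H →L[ℂ] H} (hX : IsSelfAdjoint X) (hY : IsSelfAdjoint Y)
      (h : Y * X = X * Y) : IsSelfAdjoint (X * Y) := by
    rw [isSelfAdjoint_iff, star_mul, hX.star_eq, hY.star_eq, h]
  have cp0 : (B₀ + B₁) * A₀ = A₀ * (B₀ + B₁) := by rw [add_mul, mul_add, h00, h10]
  have cp1 : (B₀ + B₁) * A₁ = A₁ * (B₀ + B₁) := by rw [add_mul, mul_add, h01, h11]
  have cm0 : (B₀ - B₁) * A₀ = A₀ * (B₀ - B₁) := by rw [sub_mul, mul_sub, h00, h10]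
  have cm1 : (B₀ - B₁) * A₁ = A₁ * (B₀ - B₁) := by rw [sub_mul, mul_sub, h01, h11]
  have sP := sB₀.add sB₁
  have sM := sB₀.sub sB₁
  obtain ⟨P, hP⟩ : ∃ X, X = B₀ + B₁ := ⟨_, rfl⟩
  obtain ⟨M, hM⟩ : ∃ X, X = B₀ - B₁ := ⟨_, rfl⟩
  have hPM : M * M = (4 : ℂ) • 1 - P * P := by
    rw [hP, hM]
    simp only [mul_add, add_mul, mul_sub, sub_mul, hB₀, hB₁]
    module
  rw [← hP] at eB e0 cp0 cp1 sP hBe hT ⊢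
  rw [← hM] at e1 cm0 cm1 sM hBe hT ⊢
  have sBe : IsSelfAdjoint Be := by
    rw [hBe]
    exact ((sβ.smul sA₀).add (comm_sa sA₀ sP cp0)).add (comm_sa sA₁ sM cm1)
  have sT : IsSelfAdjoint T := by
    rw [hT]
    exact ((sβ.smul sA₁).sub (comm_sa sA₀ sM cm0)).sub (comm_sa sA₁ sP cp1)
  have hηβ : 2 * (β * β) + 8 = (4 * c) * (4 * c) := by
    rw [hβ]; linear_combination (8 * c ^ 2) * hsk - 8 * hc
  have hval : β * k + 2 * c + 2 * c * s ^ 2 = 4 * c := by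
    rw [hβ]; linear_combination (2 * c) * hsk
  -- The slack 4c - `Be`. By the sum-of-squares identity S² + T² = 8c S, and S has expectation 0, so
  -- both S and T kill ψ.
  obtain ⟨S, hS⟩ : ∃ X, X = ((4 * c : ℝ) : ℂ) • 1 - Be := ⟨_, rfl⟩
  have sS : IsSelfAdjoint S := by
    rw [hS]
    refine IsSelfAdjoint.sub (IsSelfAdjoint.smul ?_ (IsSelfAdjoint.one _)) sBe
    simp [isSelfAdjoint_iff]
  have hST : S * S + T * T = ((2 * (4 * c) : ℝ) : ℂ) • S := by
    have : S * S + T * T = (((4 * c : ℝ) : ℂ) * ((4 * c : ℝ) : ℂ)) • 1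
        - (2 * ((4 * c : ℝ) : ℂ)) • Be + (Be * Be + T * T) := by
      rw [hS]
      simp only [mul_sub, sub_mul, smul_mul_assoc, mul_smul_comm, one_mul, mul_one]
      module
    rw [this, hsq, hS]
    have h' : 2 * ((β : ℂ) * β) + 8 = ((4 * c : ℝ) : ℂ) * ((4 * c : ℝ) : ℂ) := by
      exact_mod_cast hηβ
    rw [h']
    push_cast
    module
  have hBe1 : inner ℂ ψ (Be ψ) = ((4 * c : ℝ) : ℂ) := by
    rw [hBe, ← hval]
    simp only [add_apply, smul_apply, inner_add_right,
      inner_smul_right, eA, e0, e1]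
    push_cast
    ring
  have hS1 : inner ℂ ψ (S ψ) = 0 := by
    rw [hS]
    simp only [sub_apply, smul_apply, inner_sub_right,
      inner_smul_right, hBe1, one_apply_eq_self, hψ', mul_one, sub_self]
  have hnorm : ‖S ψ‖ ^ 2 + ‖T ψ‖ ^ 2 = 0 := by
    have h := congrArg (fun X : H →L[ℂ] H => inner ℂ ψ (X ψ)) hST
    simp only [add_apply, smul_apply, inner_add_right,
      inner_smul_right, hS1, mul_zero, norm_sq_apply_of_isSelfAdjoint sS,
      norm_sq_apply_of_isSelfAdjoint sT] at h
    exact_mod_cast h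
  have hSψ : S ψ = 0 := by
    have : ‖S ψ‖ ^ 2 = 0 := by nlinarith [sq_nonneg ‖S ψ‖, sq_nonneg ‖T ψ‖]
    simpa using this
  have hTψ : T ψ = 0 := by
    have : ‖T ψ‖ ^ 2 = 0 := by nlinarith [sq_nonneg ‖S ψ‖, sq_nonneg ‖T ψ‖]
    simpa using this
  have pA₀ (x : H) : A₀ (A₀ x) = x := by rw [← mul_apply_eq_comp, hA₀]; rfl
  have pA₁ (x : H) : A₁ (A₁ x) = x := by rw [← mul_apply_eq_comp, hA₁]; rfl
  have pm0 (x : H) : M (A₀ x) = A₀ (M x) := by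
    rw [← mul_apply_eq_comp, cm0]; rfl
  have q1 : (β : ℂ) • A₀ ψ + A₀ (P ψ) + A₁ (M ψ) = ((4 * c : ℝ) : ℂ) • ψ := by
    rw [hS, hBe] at hSψ
    simp only [sub_apply, add_apply, smul_apply, mul_apply_eq_comp, one_apply_eq_self,
      sub_eq_zero] at hSψ
    exact hSψ.symm
  have q2 : A₀ (M ψ) = (β : ℂ) • A₁ ψ - A₁ (P ψ) := by
    rw [hT] at hTψ
    simp only [sub_apply, smul_apply,
      mul_apply_eq_comp] at hTψ
    rw [← sub_eq_zero, ← neg_eq_zero, ← hTψ]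
    abel
  have unit_norm {X : H →L[ℂ] H} (hX : IsSelfAdjoint X) (hXX : X * X = 1) (x : H) :
      ‖X x‖ = ‖x‖ := by
    have h := norm_sq_apply_of_isSelfAdjoint hX x
    rw [hXX, one_apply_eq_self, inner_self_eq_norm_sq_to_K] at h
    have h' : ‖x‖ ^ 2 = ‖X x‖ ^ 2 := Complex.ofReal_injective (by rw [← h]; norm_cast)
    exact ((sq_eq_sq₀ (norm_nonneg _) (norm_nonneg _)).1 h').symm
  -- `A₀` and `A₁` are isometries, so `q2` is an equality of norms. Together with M² = 4 - P² it
  -- determines ‖P ψ‖.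
  have n1 : ‖M ψ‖ = ‖(β : ℂ) • ψ - P ψ‖ := by
    rw [← unit_norm sA₀ hA₀ (M ψ), q2, ← unit_norm sA₁ hA₁ ((β : ℂ) • ψ - P ψ), map_sub, map_smul]
  have n2 : ‖M ψ‖ ^ 2 = 4 - ‖P ψ‖ ^ 2 := by
    have h := norm_sq_apply_of_isSelfAdjoint sM ψ
    rw [hPM] at h
    simp only [sub_apply, smul_apply, inner_sub_right,
      inner_smul_right, one_apply_eq_self, hψ', norm_sq_apply_of_isSelfAdjoint sP] at h
    have h' : (4 : ℝ) * 1 - ‖P ψ‖ ^ 2 = ‖M ψ‖ ^ 2 := by exact_mod_cast h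
    linarith
  have n3 : ‖(β : ℂ) • ψ - P ψ‖ ^ 2 = β ^ 2 - 2 * (β * (2 * c * k)) + ‖P ψ‖ ^ 2 := by
    rw [norm_sub_sq (𝕜 := ℂ), inner_smul_left, eB, norm_smul, hψ]
    simp
  have n4 : ‖P ψ‖ ^ 2 = 4 * c ^ 2 := by
    rw [n1, n3, hβ] at n2
    linear_combination (1 / 2) * n2 + 2 * c ^ 2 * hsk - 2 * hc
  have e0' : inner ℂ (A₀ ψ) (P ψ) = ((2 * c : ℝ) : ℂ) := by
    rw [← e0]
    exact (ContinuousLinearMap.isSelfAdjoint_iff_isSymmetric.1 sA₀) ψ (P ψ)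
  -- Equality case of Cauchy–Schwarz: `P ψ` has norm 2c and inner product 2c with the unit vector
  -- `A₀ ψ`.
  have r1 : P ψ = ((2 * c : ℝ) : ℂ) • A₀ ψ := by
    rw [← sub_eq_zero, ← norm_eq_zero, ← sq_eq_zero_iff, norm_sub_rev, norm_sub_sq (𝕜 := ℂ),
      inner_smul_left, e0', norm_smul, unit_norm sA₀ hA₀, hψ, n4, Complex.conj_ofReal,
      ← Complex.ofReal_mul, Complex.norm_real, Real.norm_eq_abs, mul_one, sq_abs]
    simp only [RCLike.re_eq_complex_re, Complex.ofReal_re]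
    ring
  refine ⟨r1, ?_⟩
  have r2 : M ψ = ((2 * c : ℝ) : ℂ) • A₁ ψ - (β : ℂ) • A₁ (A₀ ψ) := by
    have h := congrArg A₁ q1
    rw [r1] at h
    simp only [map_add, map_smul, pA₀, pA₁] at h
    rw [← sub_eq_zero] at h ⊢
    rw [← h]
    push_cast
    module
  rw [map_sub, pm0, q2, r2, r1, hβ]
  simp only [map_smul, map_add]
  push_cast
  module

end TiltedCHSH

/-! ### The dimension count for pairs of idempotents. -/

section Dimension

variable {𝕜 V : Type*} [Field 𝕜] [AddCommGroup V] [Module 𝕜 V]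

/-- If an injective map sends `(1 - Π) U` into `Π U`, then `Π U` has at least half the dimension
of `U`. -/
theorem finrank_le_two_mul_finrank_map (U : Submodule 𝕜 V) [FiniteDimensional 𝕜 U]
    (Pr F : V →ₗ[𝕜] V) (hF : Function.Injective F)
    (h : ∀ u ∈ U, F (u - Pr u) ∈ U.map Pr) :
    Module.finrank 𝕜 U ≤ 2 * Module.finrank 𝕜 (U.map Pr) := by
  have h1 : U ≤ U.map Pr ⊔ U.map (1 - Pr) := by
    intro u hu
    refine Submodule.mem_sup.2 ⟨Pr u, Submodule.mem_map_of_mem hu, (1 - Pr) u,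
      Submodule.mem_map_of_mem hu, by simp⟩
  have h2 : Module.finrank 𝕜 (U.map (1 - Pr)) ≤ Module.finrank 𝕜 (U.map Pr) := by
    rw [(Submodule.equivMapOfInjective F hF _).finrank_eq]
    refine Submodule.finrank_mono ?_
    rintro _ ⟨_, ⟨u, hu, rfl⟩, rfl⟩
    exact h u hu
  calc Module.finrank 𝕜 U ≤ Module.finrank 𝕜 ↥(U.map Pr ⊔ U.map (1 - Pr)) :=
        Submodule.finrank_mono h1
    _ ≤ Module.finrank 𝕜 (U.map Pr) + Module.finrank 𝕜 (U.map (1 - Pr)) :=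
        Submodule.finrank_add_le_finrank_add_finrank _ _
    _ ≤ _ := by omega

/-- Two mutually annihilating idempotents on a finite-dimensional space `U`, each of rank at least
half the dimension of `U`, add up to the identity on `U`. -/
theorem add_apply_eq_self_of_finrank_le (U : Submodule 𝕜 V) [FiniteDimensional 𝕜 U]
    (Pr Pr' : V →ₗ[𝕜] V) (hU : ∀ u ∈ U, Pr u ∈ U) (hU' : ∀ u ∈ U, Pr' u ∈ U)
    (hid : ∀ u, Pr (Pr u) = Pr u) (hid' : ∀ u, Pr' (Pr' u) = Pr' u)
    (h0 : ∀ u ∈ U, Pr (Pr' u) = 0) (h0' : ∀ u ∈ U, Pr' (Pr u) = 0)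
    (hd : Module.finrank 𝕜 U ≤ 2 * Module.finrank 𝕜 (U.map Pr))
    (hd' : Module.finrank 𝕜 U ≤ 2 * Module.finrank 𝕜 (U.map Pr')) :
    ∀ u ∈ U, Pr u + Pr' u = u := by
  have hle : U.map Pr ⊔ U.map Pr' ≤ U := by
    refine sup_le ?_ ?_
    · rintro _ ⟨u, hu, rfl⟩; exact hU u hu
    · rintro _ ⟨u, hu, rfl⟩; exact hU' u hu
  have hdis : U.map Pr ⊓ U.map Pr' = ⊥ := by
    rw [eq_bot_iff]
    rintro _ ⟨⟨u, hu, rfl⟩, ⟨v, hv, hvu⟩⟩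
    rw [Submodule.mem_bot, ← hid, ← hvu, h0 v hv]
  have hsum := Submodule.finrank_sup_add_finrank_inf_eq (U.map Pr) (U.map Pr')
  rw [hdis, finrank_bot] at hsum
  -- Two subspaces of `U` with trivial intersection, each of at least half the dimension, fill `U`.
  have heq : U.map Pr ⊔ U.map Pr' = U := Submodule.eq_of_le_of_finrank_le hle (by omega)
  intro u hu
  rw [← heq] at hu
  obtain ⟨_, ⟨a, ha, rfl⟩, _, ⟨b, hb, rfl⟩, rfl⟩ := Submodule.mem_sup.1 hu
  rw [map_add, map_add, hid, hid', h0 b hb, h0' a ha, add_zero, zero_add]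

end Dimension

/-! ### Spectral projections of a self-adjoint involution. -/

section OutcomeProj

/-- The right side is an eigenvector because e² = 1, and its difference from x is orthogonal to the
eigenspace because M is symmetric and e is real. -/
theorem starProjection_eigenspace_apply {M : HZ →L[ℂ] HZ} (hM : IsSelfAdjoint M) (hMM : M * M = 1)
    {e : ℂ} (hee : e * e = 1) (hec : (starRingEnd ℂ) e = e) (x : HZ) :
    (Module.End.eigenspace (M : HZ →ₗ[ℂ] HZ) e).starProjection x
      = (1 / 2 : ℂ) • (x + e • M x) := by
  have hMM' (y : HZ) : M (M y) = y := by rw [← mul_apply_eq_comp, hMM]; rfl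
  refine (Submodule.eq_starProjection_of_mem_of_inner_eq_zero ?_ ?_)
  · rw [Module.End.mem_eigenspace_iff]
    simp only [ContinuousLinearMap.coe_coe, map_smul, map_add, hMM']
    have : M x + e • x = e • (x + e • M x) := by rw [smul_add, smul_smul, hee, one_smul, add_comm]
    rw [this, smul_comm]
  · intro w hw
    rw [Module.End.mem_eigenspace_iff] at hw
    have hw' : M w = e • w := hw
    have hsym : inner ℂ (M x) w = inner ℂ x (M w) :=
      ContinuousLinearMap.isSelfAdjoint_iff_isSymmetric.1 hM x w
    rw [inner_sub_left, inner_smul_left, inner_add_left, inner_smul_left, hsym, hw',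
      inner_smul_right, hec, ← mul_assoc, hee, one_mul,
      map_div₀, map_one, map_ofNat]
    ring

theorem outcomeProj_apply {M : HZ →L[ℂ] HZ} (hM : IsSelfAdjoint M) (hMM : M * M = 1) (a : Fin 2)
    (x : HZ) : outcomeProj M a x = (1 / 2 : ℂ) • (x + (-1 : ℂ) ^ (a : ℕ) • M x) :=
  starProjection_eigenspace_apply hM hMM
    (by rw [← pow_add, ← two_mul, pow_mul]; simp) (by simp) x

theorem isProjectiveMeasurement_outcomeProj {M : HZ →L[ℂ] HZ} (hM : IsSelfAdjoint M)
    (hMM : M * M = 1) : IsProjectiveMeasurement (outcomeProj M) := by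
  refine ⟨fun a => isStarProjection_starProjection, ?_⟩
  ext1 x
  simp only [Fin.sum_univ_two, add_apply, outcomeProj_apply hM hMM, one_apply_eq_self]
  simp only [Fin.val_zero, Fin.val_one, pow_zero, pow_one]
  module

theorem observable_outcomeProj {M : HZ →L[ℂ] HZ} (hM : IsSelfAdjoint M)
    (hMM : M * M = 1) : observable (outcomeProj M) = M := by
  ext1 x
  simp only [observable, sub_apply, outcomeProj_apply hM hMM]
  simp only [Fin.val_zero, Fin.val_one, pow_zero, pow_one]
  module

end OutcomeProj

/-! ### Qubit observables transported to ℓ²(ℤ). -/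

section ConjObs

theorem clm_ext_zKet {E : Type*} [NormedAddCommGroup E] [NormedSpace ℂ E]
    {f g : HZ →L[ℂ] E} (h : ∀ i, f (zKet i) = g (zKet i)) : f = g := by
  ext1 x
  have hs := lp.hasSum_single (p := 2) (by simp) x
  have key : ∀ i, f (lp.single 2 i (x i)) = g (lp.single 2 i (x i)) := by
    intro i
    have : (lp.single 2 i (x i) : HZ) = x i • zKet i := by
      rw [zKet, ← lp.single_smul, smul_eq_mul, mul_one]
    rw [this, map_smul, map_smul, h]
  refine (f.hasSum hs).unique ?_
  simp only [key]
  exact g.hasSum hs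

theorem conjObs_apply_isometry (W : HTensor Qubit HZ →ₗᵢ[ℂ] HZ) (σ : Matrix (Fin 2) (Fin 2) ℂ)
    (y : HTensor Qubit HZ) :
    conjObs W σ (W y) = W (opTensor (Matrix.toEuclideanCLM (𝕜 := ℂ) σ) 1 y) := by
  have : ContinuousLinearMap.adjoint W.toContinuousLinearMap (W y) = y := by
    refine ext_inner_left ℂ fun v => ?_
    rw [ContinuousLinearMap.adjoint_inner_right]
    exact W.inner_map_map v y
  simp [conjObs, this]

theorem conjObs_zKet (w : Fin 2 × ℤ → ℤ) (hw : Function.Injective w)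
    (σ : Matrix (Fin 2) (Fin 2) ℂ) (a : Fin 2) (j : ℤ) :
    conjObs (pairIsometry w hw) σ (zKet (w (a, j)))
      = σ 0 a • zKet (w (0, j)) + σ 1 a • zKet (w (1, j)) := by
  have hq : Matrix.toEuclideanCLM (𝕜 := ℂ) σ (qKet a) = σ 0 a • qKet 0 + σ 1 a • qKet 1 := by
    ext b
    fin_cases b <;> simp [qKet, Matrix.ofLp_toEuclideanCLM]
  rw [← pairIsometry_apply w hw a j, conjObs_apply_isometry, opTensor_htmul, hq, htmul_add_left,
    htmul_smul_left, htmul_smul_left]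
  simp [pairIsometry_apply]

variable (W : HTensor Qubit HZ →ₗᵢ[ℂ] HZ)

theorem conjObs_add (σ τ : Matrix (Fin 2) (Fin 2) ℂ) :
    conjObs W (σ + τ) = conjObs W σ + conjObs W τ := by
  simp [conjObs, opTensor_add_left, ContinuousLinearMap.add_comp, ContinuousLinearMap.comp_add]

theorem conjObs_smul (c : ℂ) (σ : Matrix (Fin 2) (Fin 2) ℂ) :
    conjObs W (c • σ) = c • conjObs W σ := by
  simp [conjObs, opTensor_smul_left]

theorem conjObs_sub (σ τ : Matrix (Fin 2) (Fin 2) ℂ) :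
    conjObs W (σ - τ) = conjObs W σ - conjObs W τ := by
  rw [eq_sub_iff_add_eq, ← conjObs_add, sub_add_cancel]

theorem isSelfAdjoint_conjObs {σ : Matrix (Fin 2) (Fin 2) ℂ} (hσ : σ.IsHermitian) :
    IsSelfAdjoint (conjObs W σ) := by
  have h : IsSelfAdjoint (Matrix.toEuclideanCLM (𝕜 := ℂ) σ) := by
    have h' : star σ = σ := hσ
    rw [isSelfAdjoint_iff, ← map_star, h']
  exact (isSelfAdjoint_opTensor h (IsSelfAdjoint.one _)).conj_adjoint W.toContinuousLinearMap

/-- Surjectivity of `w` matters: otherwise the square would only be the projection onto the range of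
the isometry. -/
theorem conjObs_mul_self {w : Fin 2 × ℤ → ℤ} (hw : Function.Bijective w)
    {σ : Matrix (Fin 2) (Fin 2) ℂ} (hσ : σ * σ = 1) :
    conjObs (pairIsometry w hw.1) σ * conjObs (pairIsometry w hw.1) σ = 1 := by
  refine clm_ext_zKet fun i => ?_
  obtain ⟨⟨a, j⟩, rfl⟩ := hw.2 i
  rw [← pairIsometry_apply w hw.1, mul_apply_eq_comp, conjObs_apply_isometry,
    conjObs_apply_isometry, ← mul_apply_eq_comp (opTensor _ _), opTensor_mul, ← map_mul, hσ,
    map_one, one_mul, opTensor_one_one]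
  rfl

end ConjObs

/-! ### Operators and expectations on the state Ψ. -/

section State

/-- The product basis vector `|i⟩|i⟩`. -/
def zzKet (i : ℤ) : HTensor HZ HZ := htmul (zKet i) (zKet i)

theorem orthonormal_zzKet : Orthonormal ℂ zzKet := by
  rw [orthonormal_iff_ite]
  intro i j
  simp only [zzKet, inner_htmul, orthonormal_iff_ite.1 orthonormal_zKet i j]
  split_ifs <;> simp

theorem summable_pow_natAbs {x : ℝ} (h0 : 0 ≤ x) (h1 : x < 1) :
    Summable fun i : ℤ => x ^ i.natAbs := by
  refine Summable.of_nat_of_neg ?_ ?_ <;> simpa using summable_geometric_of_lt_one h0 h1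

variable {α : ℝ}

theorem summable_pow_two_mul_natAbs (h0 : 0 < α) (h1 : α < 1) :
    Summable fun i : ℤ => α ^ (2 * i.natAbs) := by
  simp only [pow_mul]
  exact summable_pow_natAbs (by positivity) (by nlinarith)

theorem normC_pos (h0 : 0 < α) (h1 : α < 1) : 0 < normC α :=
  (summable_pow_two_mul_natAbs h0 h1).tsum_pos (fun i => by positivity) 0 (by simp)

theorem summable_zzKet (h0 : 0 < α) (h1 : α < 1) :
    Summable fun i : ℤ => ((α ^ i.natAbs : ℝ) : ℂ) • zzKet i := by
  refine Summable.of_norm ?_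
  refine (summable_pow_natAbs h0.le h1).congr fun i => ?_
  rw [norm_smul, orthonormal_zzKet.1 i, Complex.norm_real, Real.norm_eq_abs,
    abs_of_pos (by positivity), mul_one]

theorem Psi_eq (α : ℝ) : Psi α = (((1 / √(normC α) : ℝ)) : ℂ) •
    ∑' i : ℤ, ((α ^ i.natAbs : ℝ) : ℂ) • zzKet i := rfl

/-- Bounded operators that agree on all `|i⟩|i⟩` agree on the state. -/
theorem apply_Psi_congr (h0 : 0 < α) (h1 : α < 1) {O O' : HTensor HZ HZ →L[ℂ] HTensor HZ HZ}
    (h : ∀ i, O (zzKet i) = O' (zzKet i)) : O (Psi α) = O' (Psi α) := by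
  rw [Psi_eq, map_smul, map_smul, O.map_tsum (summable_zzKet h0 h1),
    O'.map_tsum (summable_zzKet h0 h1)]
  simp only [map_smul, h]

/-- The expectation value of an operator that permutes the vectors `|i⟩|i⟩` up to factors. -/
theorem inner_Psi_apply (h0 : 0 < α) (h1 : α < 1) {O : HTensor HZ HZ →L[ℂ] HTensor HZ HZ}
    {d : ℤ → ℝ} {g : ℤ → ℤ} (h : ∀ i, O (zzKet i) = (d i : ℂ) • zzKet (g i)) :
    inner ℂ (Psi α) (O (Psi α))
      = (((∑' i : ℤ, α ^ i.natAbs * (d i * α ^ (g i).natAbs)) / normC α : ℝ) : ℂ) := by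
  obtain ⟨v, hv⟩ : ∃ v, v = ∑' i : ℤ, ((α ^ i.natAbs : ℝ) : ℂ) • zzKet i := ⟨_, rfl⟩
  have hs : HasSum (fun i : ℤ => ((α ^ i.natAbs : ℝ) : ℂ) • zzKet i) v :=
    hv ▸ (summable_zzKet h0 h1).hasSum
  have hvj (j : ℤ) : inner ℂ v (zzKet j) = ((α ^ j.natAbs : ℝ) : ℂ) := by
    have h2 := (innerSL ℂ (zzKet j)).hasSum hs
    have h3 : inner ℂ (zzKet j) v = ((α ^ j.natAbs : ℝ) : ℂ) := by
      refine h2.unique ?_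
      convert! hasSum_ite_eq j ((α ^ j.natAbs : ℝ) : ℂ) using 2 with i
      simp only [innerSL_apply_apply, inner_smul_right,
        orthonormal_iff_ite.1 orthonormal_zzKet j i]
      split_ifs with h4 h5 h5
      · rw [h4, mul_one]
      · exact absurd h4.symm h5
      · exact absurd h5.symm h4
      · simp
    rw [← inner_conj_symm, h3, Complex.conj_ofReal]
  have hO := ((innerSL ℂ v) ∘L O).hasSum hs
  have hO' : inner ℂ v (O v) = ((∑' i : ℤ, α ^ i.natAbs * (d i * α ^ (g i).natAbs) : ℝ) : ℂ) := by
    rw [Complex.ofReal_tsum]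
    refine hO.tsum_eq.symm.trans (tsum_congr fun i => ?_)
    simp only [ContinuousLinearMap.comp_apply, innerSL_apply_apply, map_smul, h, hvj]
    push_cast
    ring
  have hC := normC_pos h0 h1
  have hN : (1 / √(normC α)) * (1 / √(normC α)) = 1 / normC α := by
    rw [div_mul_div_comm, Real.mul_self_sqrt hC.le, one_mul]
  rw [Psi_eq, ← hv, map_smul, inner_smul_left, inner_smul_right, hO', Complex.conj_ofReal,
    ← Complex.ofReal_mul, ← Complex.ofReal_mul, ← mul_assoc, hN, div_mul_eq_mul_div, one_mul]

theorem norm_Psi (h0 : 0 < α) (h1 : α < 1) : ‖Psi α‖ = 1 := by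
  -- The squared norm is the expectation of the identity.
  have h := inner_Psi_apply h0 h1 (O := 1) (d := fun _ => 1) (g := id) (by simp)
  have h2 : ∑' i : ℤ, α ^ i.natAbs * (1 * α ^ (id i).natAbs) = normC α :=
    tsum_congr fun i => by simp only [id, one_mul]; ring
  rw [h2, div_self (normC_pos h0 h1).ne', one_apply_eq_self, inner_self_eq_norm_sq_to_K] at h
  have h3 : ‖Psi α‖ ^ 2 = 1 := Complex.ofReal_injective (by rw [← h]; norm_cast)
  exact (pow_eq_one_iff_of_nonneg (norm_nonneg _) two_ne_zero).1 h3

end State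

/-- `cos 2θ` for `tan θ = α`. -/
def cosTwoTheta (α : ℝ) : ℝ := (1 - α ^ 2) / (1 + α ^ 2)

/-- `sin 2θ` for `tan θ = α`. -/
def sinTwoTheta (α : ℝ) : ℝ := 2 * α / (1 + α ^ 2)

/-! ### Trigonometry of θ and μ. -/

section Angles

theorem sinTwoTheta_sq_add_cosTwoTheta_sq (α : ℝ) :
    sinTwoTheta α ^ 2 + cosTwoTheta α ^ 2 = 1 := by
  have : 1 + α ^ 2 ≠ 0 := by positivity
  rw [sinTwoTheta, cosTwoTheta]
  field_simp
  ring

theorem sin_two_mul_arctan (α : ℝ) : Real.sin (2 * Real.arctan α) = sinTwoTheta α := by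
  have h : 0 < 1 + α ^ 2 := by positivity
  rw [Real.sin_two_mul, Real.sin_arctan, Real.cos_arctan, sinTwoTheta, mul_assoc, div_mul_div_comm,
    Real.mul_self_sqrt h.le, mul_one, mul_div_assoc]

theorem cos_mu_pos (α : ℝ) : 0 < Real.cos (mu α) := Real.cos_arctan_pos _

theorem cos_mu_sq_mul (α : ℝ) : Real.cos (mu α) ^ 2 * (1 + sinTwoTheta α ^ 2) = 1 := by
  rw [mu, Real.cos_sq_arctan, sin_two_mul_arctan]
  have : 1 + sinTwoTheta α ^ 2 ≠ 0 := by positivity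
  field_simp

theorem sin_mu (α : ℝ) : Real.sin (mu α) = Real.cos (mu α) * sinTwoTheta α := by
  rw [mu, Real.sin_arctan, Real.cos_arctan, sin_two_mul_arctan]
  ring

theorem cosTwoTheta_pos {α : ℝ} (h0 : 0 < α) (h1 : α < 1) : 0 < cosTwoTheta α :=
  div_pos (by nlinarith) (by positivity)

theorem cosTwoTheta_lt_one {α : ℝ} (h0 : 0 < α) : cosTwoTheta α < 1 := by
  rw [cosTwoTheta, div_lt_one (by positivity)]
  nlinarith [pow_pos h0 2]

end Angles

/-! ### Pauli algebra of the tilted observables. -/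

section Pauli

theorem sigmaZ_isHermitian : sigmaZ.IsHermitian := by
  ext i j; fin_cases i <;> fin_cases j <;> simp [sigmaZ]

theorem sigmaX_isHermitian : sigmaX.IsHermitian := by
  ext i j; fin_cases i <;> fin_cases j <;> simp [sigmaX]

theorem sigmaZ_mul_self : sigmaZ * sigmaZ = 1 := by
  ext i j; fin_cases i <;> fin_cases j <;> simp [sigmaZ]

theorem sigmaX_mul_self : sigmaX * sigmaX = 1 := by
  ext i j; fin_cases i <;> fin_cases j <;> simp [sigmaX]

theorem sigmaZ_mul_sigmaX : sigmaZ * sigmaX = -(sigmaX * sigmaZ) := by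
  ext i j; fin_cases i <;> fin_cases j <;> simp [sigmaX, sigmaZ]

theorem isHermitian_ofReal_smul {σ : Matrix (Fin 2) (Fin 2) ℂ} (hσ : σ.IsHermitian) (c : ℝ) :
    ((c : ℂ) • σ).IsHermitian := by
  rw [Matrix.IsHermitian, Matrix.conjTranspose_smul, hσ.eq]
  simp

theorem sigmaZα_isHermitian (α : ℝ) : (sigmaZα α).IsHermitian :=
  (isHermitian_ofReal_smul sigmaZ_isHermitian _).add (isHermitian_ofReal_smul sigmaX_isHermitian _)

theorem sigmaXα_isHermitian (α : ℝ) : (sigmaXα α).IsHermitian :=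
  (isHermitian_ofReal_smul sigmaZ_isHermitian _).sub (isHermitian_ofReal_smul sigmaX_isHermitian _)

theorem cos_mu_sq_add_sin_mu_sq (α : ℝ) :
    (Real.cos (mu α) : ℂ) * Real.cos (mu α) + (Real.sin (mu α) : ℂ) * Real.sin (mu α) = 1 := by
  have := Real.cos_sq_add_sin_sq (mu α)
  rw [sq, sq] at this
  exact_mod_cast this

theorem sigmaZα_mul_self (α : ℝ) : sigmaZα α * sigmaZα α = 1 := by
  have : sigmaZα α * sigmaZα α = ((Real.cos (mu α) : ℂ) * Real.cos (mu α)
      + (Real.sin (mu α) : ℂ) * Real.sin (mu α)) • 1 := by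
    simp only [sigmaZα, add_mul, mul_add, smul_mul_assoc, mul_smul_comm, sigmaZ_mul_self,
      sigmaX_mul_self, sigmaZ_mul_sigmaX]
    module
  rw [this, cos_mu_sq_add_sin_mu_sq, one_smul]

theorem sigmaXα_mul_self (α : ℝ) : sigmaXα α * sigmaXα α = 1 := by
  have : sigmaXα α * sigmaXα α = ((Real.cos (mu α) : ℂ) * Real.cos (mu α)
      + (Real.sin (mu α) : ℂ) * Real.sin (mu α)) • 1 := by
    simp only [sigmaXα, sub_mul, mul_sub, smul_mul_assoc, mul_smul_comm, sigmaZ_mul_self,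
      sigmaX_mul_self, sigmaZ_mul_sigmaX]
    module
  rw [this, cos_mu_sq_add_sin_mu_sq, one_smul]

theorem sigmaZα_add_sigmaXα (α : ℝ) :
    sigmaZα α + sigmaXα α = ((2 * Real.cos (mu α) : ℝ) : ℂ) • sigmaZ := by
  rw [sigmaZα, sigmaXα]; push_cast; module

theorem sigmaZα_sub_sigmaXα (α : ℝ) :
    sigmaZα α - sigmaXα α = ((2 * Real.sin (mu α) : ℝ) : ℂ) • sigmaX := by
  rw [sigmaZα, sigmaXα]; push_cast; module

end Pauli

/-- A pairing of the integers such that in each pair the second member is further from `0` by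
one. -/
structure IsUnitStepPairing (w : Fin 2 × ℤ → ℤ) : Prop where
  bijective : Function.Bijective w
  natAbs_one : ∀ j, (w (1, j)).natAbs = (w (0, j)).natAbs + 1

theorem isUnitStepPairing_w0 : IsUnitStepPairing w0 where
  bijective := by
    refine ⟨w0_injective, fun i => ?_⟩
    rcases Int.even_or_odd' i with ⟨j, rfl | rfl⟩ <;> rcases le_or_gt 0 j with hj | hj
    · exact ⟨(0, j), by simp [w0, hj]⟩
    · exact ⟨(1, j), by simp [w0, hj.not_ge]⟩
    · exact ⟨(1, j), by simp [w0, hj]⟩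
    · exact ⟨(0, j), by simp [w0, hj.not_ge]⟩
  natAbs_one j := by
    simp only [w0, one_ne_zero, if_true, if_false]
    split_ifs <;> omega

theorem isUnitStepPairing_w2 : IsUnitStepPairing w2 where
  bijective := by
    refine ⟨w2_injective, fun i => ?_⟩
    -- The pairs are {2j-1, 2j}, so the parity split is applied to i + 1 to give both members the
    -- same j.
    rcases Int.even_or_odd' (i + 1) with ⟨j, hi | hi⟩ <;> rcases lt_or_ge 0 j with hj | hj
    · exact ⟨(0, j), by simp [w2, hj]; omega⟩
    · exact ⟨(1, j), by simp [w2, hj.not_gt]; omega⟩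
    · exact ⟨(1, j), by simp [w2, hj]; omega⟩
    · exact ⟨(0, j), by simp [w2, hj.not_gt]; omega⟩
  natAbs_one j := by
    simp only [w2, one_ne_zero, if_true, if_false]
    split_ifs <;> omega

/-- Second members for `w0` are the positive odd and negative even integers, for `w2` the positive
even and negative odd ones. Only 0 is missed by both. -/
theorem w0_one_ne_w2_one (i j : ℤ) : w0 (1, i) ≠ w2 (1, j) := by
  simp only [w0, w2, one_ne_zero, if_false]
  split_ifs <;> omega

/-! ### Expectation values in the model. -/

section Expectations

variable {w : Fin 2 × ℤ → ℤ} {α : ℝ}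

/-- The two members of a pair contribute to a sum in a constant ratio. -/
theorem IsUnitStepPairing.tsum_eq (hw : IsUnitStepPairing w) {F : ℤ → ℝ} {q : Fin 2 → ℝ}
    (h0 : 0 < α) (h1 : α < 1)
    (hF : ∀ a j, F (w (a, j)) = q a * α ^ (2 * (w (0, j)).natAbs)) :
    ∑' i, F i = (q 0 + q 1) * ∑' j, α ^ (2 * (w (0, j)).natAbs) := by
  rw [← (Equiv.ofBijective w hw.bijective).tsum_eq F]
  have hs : Summable fun j => α ^ (2 * (w (0, j)).natAbs) :=
    (summable_pow_two_mul_natAbs h0 h1).comp_injective (i := fun j => w (0, j))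
      fun i j h => (Prod.ext_iff.1 (hw.bijective.1 h)).2
  have h := tsum_mul_tsum_of_summable_norm (f := q) (Summable.of_norm_bounded_eventually
    (g := 0) summable_zero (by simp)) hs.norm
  rw [tsum_fintype, Fin.sum_univ_two] at h
  rw [h]
  exact tsum_congr fun x => hF x.1 x.2

theorem IsUnitStepPairing.tsum_div_normC (hw : IsUnitStepPairing w) {F : ℤ → ℝ} {q : Fin 2 → ℝ}
    (h0 : 0 < α) (h1 : α < 1)
    (hF : ∀ a j, F (w (a, j)) = q a * α ^ (2 * (w (0, j)).natAbs)) :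
    (∑' i, F i) / normC α = (q 0 + q 1) / (1 + α ^ 2) := by
  have hC := normC_pos h0 h1
  -- The normalization is itself a sum over pairs, with weights 1 and α², so the common sum over j
  -- cancels without being evaluated.
  have h2 := hw.tsum_eq (F := fun i => α ^ (2 * i.natAbs)) (q := ![1, α ^ 2]) h0 h1 (by
    intro a j
    fin_cases a
    · simp
    · simp [hw.natAbs_one]; ring)
  rw [normC] at hC ⊢
  rw [h2] at hC ⊢
  rw [hw.tsum_eq h0 h1 hF]
  have := right_ne_zero_of_mul hC.ne'
  rw [mul_div_mul_right _ _ this]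
  simp

/-- `W σ_z W†` on basis vectors. -/
theorem conjObs_sigmaZ_zKet (hw : IsUnitStepPairing w) (a : Fin 2) (j : ℤ) :
    conjObs (pairIsometry w hw.bijective.1) sigmaZ (zKet (w (a, j)))
      = ((-1 : ℂ) ^ (a : ℕ)) • zKet (w (a, j)) := by
  rw [conjObs_zKet]
  fin_cases a <;> simp [sigmaZ]

/-- `W σ_x W†` on basis vectors. -/
theorem conjObs_sigmaX_zKet (hw : IsUnitStepPairing w) (a : Fin 2) (j : ℤ) :
    conjObs (pairIsometry w hw.bijective.1) sigmaX (zKet (w (a, j)))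
      = zKet (w (1 - a, j)) := by
  rw [conjObs_zKet]
  fin_cases a <;> simp [sigmaX]

/-- The sign with which `W σ_z W†` acts on `|i⟩`, and the partner of `i`. -/
theorem IsUnitStepPairing.exists_sign_partner (hw : IsUnitStepPairing w) :
    ∃ (d : ℤ → ℝ) (g : ℤ → ℤ), (∀ a j, d (w (a, j)) = (-1) ^ (a : ℕ)) ∧
      ∀ a j, g (w (a, j)) = w (1 - a, j) := by
  let e := Equiv.ofBijective w hw.bijective
  have he (a : Fin 2) (j : ℤ) : e.symm (w (a, j)) = (a, j) := e.symm_apply_apply (a, j)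
  exact ⟨fun i => (-1) ^ ((e.symm i).1 : ℕ), fun i => w (1 - (e.symm i).1, (e.symm i).2),
    fun a j => by simp only [he], fun a j => by simp only [he]⟩

theorem inner_Psi_sigmaZ_one (hw : IsUnitStepPairing w) (h0 : 0 < α) (h1 : α < 1) :
    inner ℂ (Psi α) (opTensor (conjObs (pairIsometry w hw.bijective.1) sigmaZ) 1 (Psi α))
      = (cosTwoTheta α : ℂ) := by
  obtain ⟨d, g, hd, -⟩ := hw.exists_sign_partner
  rw [inner_Psi_apply h0 h1 (d := d) (g := id), hw.tsum_div_normC (q := ![1, -α ^ 2]) h0 h1]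
  · simp [cosTwoTheta, sub_eq_add_neg]
  · intro a j
    simp only [hd, id]
    fin_cases a
    · simp; ring
    · simp [hw.natAbs_one]; ring
  · intro i
    obtain ⟨⟨a, j⟩, rfl⟩ := hw.bijective.2 i
    rw [zzKet, opTensor_htmul, conjObs_sigmaZ_zKet hw, htmul_smul_left, hd]
    simp [zzKet]

/-- Ψ is supported on the vectors |i⟩|i⟩, so a diagonal operator may be moved between the parties.
-/
theorem opTensor_one_sigmaZ_Psi (hw : IsUnitStepPairing w) (h0 : 0 < α) (h1 : α < 1) :
    opTensor 1 (conjObs (pairIsometry w hw.bijective.1) sigmaZ) (Psi α)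
      = opTensor (conjObs (pairIsometry w hw.bijective.1) sigmaZ) 1 (Psi α) := by
  refine apply_Psi_congr h0 h1 fun i => ?_
  obtain ⟨⟨a, j⟩, rfl⟩ := hw.bijective.2 i
  rw [zzKet, opTensor_htmul, opTensor_htmul, conjObs_sigmaZ_zKet hw, htmul_smul_left,
    htmul_smul_right]
  rfl

theorem opTensor_sigmaZ_sigmaZ_Psi (hw : IsUnitStepPairing w) (h0 : 0 < α) (h1 : α < 1) :
    opTensor (conjObs (pairIsometry w hw.bijective.1) sigmaZ)
      (conjObs (pairIsometry w hw.bijective.1) sigmaZ) (Psi α) = Psi α := by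
  refine (apply_Psi_congr h0 h1 (O' := 1) fun i => ?_)
  obtain ⟨⟨a, j⟩, rfl⟩ := hw.bijective.2 i
  rw [zzKet, opTensor_htmul, conjObs_sigmaZ_zKet hw, htmul_smul_left, htmul_smul_right, smul_smul,
    ← pow_add, ← two_mul, pow_mul]
  simp

theorem inner_Psi_sigmaX_sigmaX (hw : IsUnitStepPairing w) (h0 : 0 < α) (h1 : α < 1) :
    inner ℂ (Psi α) (opTensor (conjObs (pairIsometry w hw.bijective.1) sigmaX)
      (conjObs (pairIsometry w hw.bijective.1) sigmaX) (Psi α)) = (sinTwoTheta α : ℂ) := by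
  obtain ⟨d, g, -, hg⟩ := hw.exists_sign_partner
  rw [inner_Psi_apply h0 h1 (d := fun _ => 1) (g := g),
    hw.tsum_div_normC (q := ![α, α]) h0 h1]
  · simp [sinTwoTheta, two_mul]
  · intro a j
    simp only [hg]
    fin_cases a
    · simp [hw.natAbs_one]; ring
    · simp [hw.natAbs_one]; ring
  · intro i
    obtain ⟨⟨a, j⟩, rfl⟩ := hw.bijective.2 i
    rw [zzKet, opTensor_htmul, conjObs_sigmaX_zKet hw, hg]
    simp [zzKet]

/-- On |i⟩|i⟩ the two signs ε, ε' are never both -1, that is, (1 - ε)(1 - ε') = 0. -/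
theorem opTensor_sigmaZ_sigmaZ_cross_Psi (h0 : 0 < α) (h1 : α < 1) :
    opTensor (conjObs W0 sigmaZ) (conjObs W2 sigmaZ) (Psi α)
      = opTensor (conjObs W0 sigmaZ) 1 (Psi α) + opTensor 1 (conjObs W2 sigmaZ) (Psi α) - Psi α := by
  refine (apply_Psi_congr h0 h1 (O' := opTensor (conjObs W0 sigmaZ) 1
    + opTensor 1 (conjObs W2 sigmaZ) - 1) fun i => ?_)
  obtain ⟨⟨a, j⟩, ha⟩ := isUnitStepPairing_w0.bijective.2 i
  obtain ⟨⟨b, l⟩, hb⟩ := isUnitStepPairing_w2.bijective.2 i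
  have e0 : conjObs W0 sigmaZ (zKet i) = ((-1 : ℂ) ^ (a : ℕ)) • zKet i :=
    ha ▸ conjObs_sigmaZ_zKet isUnitStepPairing_w0 a j
  have e2 : conjObs W2 sigmaZ (zKet i) = ((-1 : ℂ) ^ (b : ℕ)) • zKet i :=
    hb ▸ conjObs_sigmaZ_zKet isUnitStepPairing_w2 b l
  have hne : ¬ (a = 1 ∧ b = 1) := by
    rintro ⟨rfl, rfl⟩
    exact w0_one_ne_w2_one j l (ha.trans hb.symm)
  simp only [zzKet, sub_apply, add_apply, opTensor_htmul, e0, e2, htmul_smul_left,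
    htmul_smul_right, one_apply_eq_self]
  fin_cases a <;> fin_cases b <;> simp at hne ⊢

end Expectations

/-! ### The infinite-dimensional strategy. -/

section Model

variable {α : ℝ}

theorem isSelfAdjoint_obsA (s : Fin 4) : IsSelfAdjoint (obsA s) := by
  fin_cases s <;>
    first
    | exact isSelfAdjoint_conjObs _ sigmaZ_isHermitian
    | exact isSelfAdjoint_conjObs _ sigmaX_isHermitian

theorem obsA_mul_self (s : Fin 4) : obsA s * obsA s = 1 := by
  fin_cases s
  · exact conjObs_mul_self isUnitStepPairing_w0.bijective sigmaZ_mul_self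
  · exact conjObs_mul_self isUnitStepPairing_w0.bijective sigmaX_mul_self
  · exact conjObs_mul_self isUnitStepPairing_w2.bijective sigmaZ_mul_self
  · exact conjObs_mul_self isUnitStepPairing_w2.bijective sigmaX_mul_self

theorem isSelfAdjoint_obsB (t : Fin 4) : IsSelfAdjoint (obsB α t) := by
  fin_cases t <;>
    first
    | exact isSelfAdjoint_conjObs _ (sigmaZα_isHermitian α)
    | exact isSelfAdjoint_conjObs _ (sigmaXα_isHermitian α)

theorem obsB_mul_self (t : Fin 4) : obsB α t * obsB α t = 1 := by
  fin_cases t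
  · exact conjObs_mul_self isUnitStepPairing_w0.bijective (sigmaZα_mul_self α)
  · exact conjObs_mul_self isUnitStepPairing_w0.bijective (sigmaXα_mul_self α)
  · exact conjObs_mul_self isUnitStepPairing_w2.bijective (sigmaZα_mul_self α)
  · exact conjObs_mul_self isUnitStepPairing_w2.bijective (sigmaXα_mul_self α)

/-- Shows that the real part taken in `corr` loses nothing. -/
theorem inner_apply_eq_ofReal_of_isStarProjection {H : Type*} [NormedAddCommGroup H]
    [InnerProductSpace ℂ H] [CompleteSpace H] {R : H →L[ℂ] H} (hR : IsStarProjection R) (x : H) :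
    ((inner ℂ x (R x)).re : ℂ) = inner ℂ x (R x) := by
  have h := norm_sq_apply_of_isSelfAdjoint hR.isSelfAdjoint x
  rw [hR.isIdempotentElem.eq] at h
  rw [h, Complex.ofReal_re]

theorem generates_corr (h0 : 0 < α) (h1 : α < 1) :
    Generates (Psi α) (fun s a => outcomeProj (obsA s) a) (fun t b => outcomeProj (obsB α t) b)
      (corr α) :=
  ⟨norm_Psi h0 h1,
    fun s => isProjectiveMeasurement_outcomeProj (isSelfAdjoint_obsA s) (obsA_mul_self s),
    fun t => isProjectiveMeasurement_outcomeProj (isSelfAdjoint_obsB t) (obsB_mul_self t),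
    fun _ _ _ _ => inner_apply_eq_ofReal_of_isStarProjection
      (isStarProjection_opTensor isStarProjection_starProjection isStarProjection_starProjection) _⟩

instance separableSpace_HZ : TopologicalSpace.SeparableSpace HZ := by
  have h : TopologicalSpace.IsSeparable (closure (Submodule.span ℂ (Set.range zKet) : Set HZ)) :=
    (Set.countable_range zKet).isSeparable.span.closure
  rw [← TopologicalSpace.isSeparable_univ_iff]
  refine h.mono fun x _ => ?_
  refine mem_closure_of_tendsto (lp.hasSum_single (p := 2) (by simp) x)
    (Filter.Eventually.of_forall fun t => Submodule.sum_mem _ fun i _ => ?_)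
  have : (lp.single 2 i (x i) : HZ) = x i • zKet i := by
    rw [zKet, ← lp.single_smul, smul_eq_mul, mul_one]
  rw [this]
  exact Submodule.smul_mem _ _ (Submodule.subset_span ⟨i, rfl⟩)

theorem corr_mem_Cqs (h0 : 0 < α) (h1 : α < 1) : corr α ∈ Cqs 4 4 2 2 :=
  ⟨HZ, inferInstance, inferInstance, inferInstance, inferInstance,
    HZ, inferInstance, inferInstance, inferInstance, inferInstance, _, _, _, generates_corr h0 h1⟩

end Model

/-! ### From the model to an arbitrary strategy with the same correlation. -/

section Transfer

variable {α : ℝ} {H K : Type*} [NormedAddCommGroup H] [InnerProductSpace ℂ H] [CompleteSpace H]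
  [NormedAddCommGroup K] [InnerProductSpace ℂ K] [CompleteSpace K] {ψ : HTensor H K}
  {P : Fin 4 → Fin 2 → H →L[ℂ] H} {Q : Fin 4 → Fin 2 → K →L[ℂ] K}

/-- Both sides are the same combination of the entries of `corr α`, so expectations can be computed
in the model. -/
theorem Generates.inner_observables_eq_Psi (h : Generates ψ P Q (corr α)) (h0 : 0 < α)
    (h1 : α < 1) (s t : Fin 4) :
    inner ℂ ψ (opTensor (observable (P s)) (observable (Q t)) ψ)
      = inner ℂ (Psi α) (opTensor (obsA s) (obsB α t) (Psi α)) := by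
  have h' := (generates_corr h0 h1).inner_observables s t
  rw [observable_outcomeProj (isSelfAdjoint_obsA s) (obsA_mul_self s),
    observable_outcomeProj (isSelfAdjoint_obsB t) (obsB_mul_self t)] at h'
  rw [h.inner_observables, h']

theorem Generates.inner_observable_left_eq_Psi (h : Generates ψ P Q (corr α)) (h0 : 0 < α)
    (h1 : α < 1) (s : Fin 4) :
    inner ℂ ψ (opTensor (observable (P s)) 1 ψ)
      = inner ℂ (Psi α) (opTensor (obsA s) 1 (Psi α)) := by
  have h' := (generates_corr h0 h1).inner_observable_left s 0
  rw [observable_outcomeProj (isSelfAdjoint_obsA s) (obsA_mul_self s)] at h'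
  rw [h.inner_observable_left s 0, h']

theorem Generates.inner_observable_right_eq_Psi (h : Generates ψ P Q (corr α)) (h0 : 0 < α)
    (h1 : α < 1) (t : Fin 4) :
    inner ℂ ψ (opTensor 1 (observable (Q t)) ψ)
      = inner ℂ (Psi α) (opTensor 1 (obsB α t) (Psi α)) := by
  have h' := (generates_corr h0 h1).inner_observable_right 0 t
  rw [observable_outcomeProj (isSelfAdjoint_obsB t) (obsB_mul_self t)] at h'
  rw [h.inner_observable_right 0 t, h']

theorem isSelfAdjoint_opTensor_one {S : H →L[ℂ] H} (hS : IsSelfAdjoint S) :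
    IsSelfAdjoint (opTensor S (1 : K →L[ℂ] K)) :=
  isSelfAdjoint_opTensor hS (IsSelfAdjoint.one _)

theorem isSelfAdjoint_one_opTensor {T : K →L[ℂ] K} (hT : IsSelfAdjoint T) :
    IsSelfAdjoint (opTensor (1 : H →L[ℂ] H) T) :=
  isSelfAdjoint_opTensor (IsSelfAdjoint.one _) hT

/-- Any strategy for the correlation satisfies the tilted CHSH relations on each of the two blocks
of questions. -/
theorem Generates.rigidity (h : Generates ψ P Q (corr α)) (h0 : 0 < α) (h1 : α < 1)
    {w : Fin 2 × ℤ → ℤ} (hw : IsUnitStepPairing w) {r r' : Fin 4}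
    (hA : obsA r = conjObs (pairIsometry w hw.bijective.1) sigmaZ)
    (hA' : obsA r' = conjObs (pairIsometry w hw.bijective.1) sigmaX)
    (hB : obsB α r = conjObs (pairIsometry w hw.bijective.1) (sigmaZα α))
    (hB' : obsB α r' = conjObs (pairIsometry w hw.bijective.1) (sigmaXα α)) :
    opTensor 1 (observable (Q r) + observable (Q r')) ψ
        = ((2 * Real.cos (mu α) : ℝ) : ℂ) • opTensor (observable (P r)) 1 ψ ∧
      opTensor 1 (observable (Q r) - observable (Q r')) (ψ - opTensor (observable (P r)) 1 ψ)
        = ((2 * Real.cos (mu α) * (1 - cosTwoTheta α) : ℝ) : ℂ) •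
          opTensor (observable (P r')) 1 (ψ + opTensor (observable (P r)) 1 ψ) := by
  have hsum : obsB α r + obsB α r' = ((2 * Real.cos (mu α) : ℝ) : ℂ) • obsA r := by
    rw [hA, hB, hB', ← conjObs_add, sigmaZα_add_sigmaXα, conjObs_smul]
  have hdiff : obsB α r - obsB α r' = ((2 * Real.sin (mu α) : ℝ) : ℂ) • obsA r' := by
    rw [hA', hB, hB', ← conjObs_sub, sigmaZα_sub_sigmaXα, conjObs_smul]
  have hψ : inner ℂ (Psi α) (Psi α) = (1 : ℂ) := by
    rw [inner_self_eq_norm_sq_to_K, norm_Psi h0 h1]; simp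
  rw [opTensor_add_right, opTensor_sub_right]
  have sq_left {S : H →L[ℂ] H} (hS : S * S = 1) :
      opTensor S (1 : K →L[ℂ] K) * opTensor S 1 = 1 := by
    rw [opTensor_mul, hS, one_mul, opTensor_one_one]
  have sq_right {T : K →L[ℂ] K} (hT : T * T = 1) :
      opTensor (1 : H →L[ℂ] H) T * opTensor 1 T = 1 := by
    rw [opTensor_mul, hT, one_mul, opTensor_one_one]
  refine tilted_chsh_rigidity h.1
    (isSelfAdjoint_opTensor_one (h.2.1 r).isSelfAdjoint_observable)
    (isSelfAdjoint_opTensor_one (h.2.1 r').isSelfAdjoint_observable)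
    (isSelfAdjoint_one_opTensor (h.2.2.1 r).isSelfAdjoint_observable)
    (isSelfAdjoint_one_opTensor (h.2.2.1 r').isSelfAdjoint_observable)
    (sq_left (h.2.1 r).observable_mul_self) (sq_left (h.2.1 r').observable_mul_self)
    (sq_right (h.2.2.1 r).observable_mul_self) (sq_right (h.2.2.1 r').observable_mul_self)
    (one_opTensor_mul_opTensor_one _ _) (one_opTensor_mul_opTensor_one _ _)
    (one_opTensor_mul_opTensor_one _ _) (one_opTensor_mul_opTensor_one _ _)
    (sinTwoTheta_sq_add_cosTwoTheta_sq α) (cos_mu_sq_mul α) ?_ ?_ ?_ ?_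
  · rw [h.inner_observable_left_eq_Psi h0 h1, hA, inner_Psi_sigmaZ_one hw h0 h1]
  · rw [add_apply, inner_add_right, h.inner_observable_right_eq_Psi h0 h1,
      h.inner_observable_right_eq_Psi h0 h1, ← inner_add_right, ← add_apply, ← opTensor_add_right,
      hsum, opTensor_smul_right, smul_apply, inner_smul_right, hA, opTensor_one_sigmaZ_Psi hw h0 h1,
      inner_Psi_sigmaZ_one hw h0 h1, ← Complex.ofReal_mul]
  · rw [mul_add, opTensor_one_mul_one, opTensor_one_mul_one, add_apply, inner_add_right,
      h.inner_observables_eq_Psi h0 h1,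
      h.inner_observables_eq_Psi h0 h1, ← inner_add_right, ← add_apply, ← opTensor_add_right,
      hsum, opTensor_smul_right, smul_apply, inner_smul_right, hA,
      opTensor_sigmaZ_sigmaZ_Psi hw h0 h1, hψ, mul_one]
  · rw [mul_sub, opTensor_one_mul_one, opTensor_one_mul_one, sub_apply, inner_sub_right,
      h.inner_observables_eq_Psi h0 h1,
      h.inner_observables_eq_Psi h0 h1, ← inner_sub_right, ← sub_apply, ← opTensor_sub_right,
      hdiff, opTensor_smul_right, smul_apply, inner_smul_right, hA',
      inner_Psi_sigmaX_sigmaX hw h0 h1, ← Complex.ofReal_mul, sin_mu]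
    congr 1
    ring

theorem Generates.rigidity_zero_one (h : Generates ψ P Q (corr α)) (h0 : 0 < α) (h1 : α < 1) :
    opTensor 1 (observable (Q 0) + observable (Q 1)) ψ
        = ((2 * Real.cos (mu α) : ℝ) : ℂ) • opTensor (observable (P 0)) 1 ψ ∧
      opTensor 1 (observable (Q 0) - observable (Q 1)) (ψ - opTensor (observable (P 0)) 1 ψ)
        = ((2 * Real.cos (mu α) * (1 - cosTwoTheta α) : ℝ) : ℂ) •
          opTensor (observable (P 1)) 1 (ψ + opTensor (observable (P 0)) 1 ψ) :=
  h.rigidity h0 h1 isUnitStepPairing_w0 rfl rfl rfl rfl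

theorem Generates.rigidity_two_three (h : Generates ψ P Q (corr α)) (h0 : 0 < α) (h1 : α < 1) :
    opTensor 1 (observable (Q 2) + observable (Q 3)) ψ
        = ((2 * Real.cos (mu α) : ℝ) : ℂ) • opTensor (observable (P 2)) 1 ψ ∧
      opTensor 1 (observable (Q 2) - observable (Q 3)) (ψ - opTensor (observable (P 2)) 1 ψ)
        = ((2 * Real.cos (mu α) * (1 - cosTwoTheta α) : ℝ) : ℂ) •
          opTensor (observable (P 3)) 1 (ψ + opTensor (observable (P 2)) 1 ψ) :=
  h.rigidity h0 h1 isUnitStepPairing_w2 rfl rfl rfl rfl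

theorem Generates.inner_left_zero (h : Generates ψ P Q (corr α)) (h0 : 0 < α) (h1 : α < 1) :
    inner ℂ ψ (opTensor (observable (P 0)) 1 ψ) = (cosTwoTheta α : ℂ) := by
  rw [h.inner_observable_left_eq_Psi h0 h1]
  exact inner_Psi_sigmaZ_one isUnitStepPairing_w0 h0 h1

theorem Generates.inner_left_two (h : Generates ψ P Q (corr α)) (h0 : 0 < α) (h1 : α < 1) :
    inner ℂ ψ (opTensor (observable (P 2)) 1 ψ) = (cosTwoTheta α : ℂ) := by
  rw [h.inner_observable_left_eq_Psi h0 h1]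
  exact inner_Psi_sigmaZ_one isUnitStepPairing_w2 h0 h1

/-- The only datum linking the two blocks: the model's cross relation gives k + k - 1, scaled by 2c.
-/
theorem Generates.inner_cross (h : Generates ψ P Q (corr α)) (h0 : 0 < α) (h1 : α < 1) :
    inner ℂ ψ (opTensor (observable (P 0)) (observable (Q 2) + observable (Q 3)) ψ)
      = ((2 * Real.cos (mu α) * (2 * cosTwoTheta α - 1) : ℝ) : ℂ) := by
  have hsum : obsB α 2 + obsB α 3 = ((2 * Real.cos (mu α) : ℝ) : ℂ) • conjObs W2 sigmaZ := by
    change conjObs W2 (sigmaZα α) + conjObs W2 (sigmaXα α) = _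
    rw [← conjObs_add, sigmaZα_add_sigmaXα, conjObs_smul]
  have hA : obsA 0 = conjObs W0 sigmaZ := rfl
  have hψ : inner ℂ (Psi α) (Psi α) = (1 : ℂ) := by
    rw [inner_self_eq_norm_sq_to_K, norm_Psi h0 h1]; simp
  have e0 : inner ℂ (Psi α) (opTensor (conjObs W0 sigmaZ) 1 (Psi α)) = (cosTwoTheta α : ℂ) :=
    inner_Psi_sigmaZ_one isUnitStepPairing_w0 h0 h1
  have e2 : inner ℂ (Psi α) (opTensor 1 (conjObs W2 sigmaZ) (Psi α)) = (cosTwoTheta α : ℂ) :=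
    (congrArg _ (opTensor_one_sigmaZ_Psi isUnitStepPairing_w2 h0 h1)).trans
      (inner_Psi_sigmaZ_one isUnitStepPairing_w2 h0 h1)
  rw [opTensor_add_right, add_apply, inner_add_right, h.inner_observables_eq_Psi h0 h1,
    h.inner_observables_eq_Psi h0 h1, ← inner_add_right, ← add_apply, ← opTensor_add_right,
    hsum, opTensor_smul_right, smul_apply, inner_smul_right, hA,
    opTensor_sigmaZ_sigmaZ_cross_Psi h0 h1, inner_sub_right, inner_add_right, e0, e2, hψ]
  push_cast
  ring

end Transfer

/-! ### The finite-dimensional contradiction. -/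

section Contradiction

/-- Two eigenprojections that are orthogonal in expectation annihilate each other on the state. -/
theorem sub_apply_sub_apply_eq_zero {H : Type*} [NormedAddCommGroup H] [InnerProductSpace ℂ H]
    [CompleteSpace H] {A A' C : H →L[ℂ] H} {ψ : H} {k : ℝ} (hψ : ‖ψ‖ = 1)
    (sA : IsSelfAdjoint A) (sC : IsSelfAdjoint C)
    (hA : A * A = 1) (hA' : A' * A' = 1) (cA : C * A = A * C) (cA' : C * A' = A' * C)
    (hC : C ψ = A' ψ) (eA : inner ℂ ψ (A ψ) = k) (eA' : inner ℂ ψ (A' ψ) = k)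
    (e : inner ℂ ψ ((A * C) ψ) = (2 * k - 1 : ℝ)) :
    (1 - A) ((1 - A') ψ) = 0 := by
  have hψ' : inner ℂ ψ ψ = (1 : ℂ) := by rw [inner_self_eq_norm_sq_to_K, hψ]; simp
  have hGG : (1 - A) * (1 - A) = (2 : ℂ) • (1 - A) := by
    simp only [mul_sub, sub_mul, hA, mul_one, one_mul]; module
  have cGD : (1 - C) * (1 - A) = (1 - A) * (1 - C) := by
    simp only [mul_sub, sub_mul, cA, mul_one, one_mul]; abel
  -- `C` stands for Bob's copy of `A'` and need not be an involution; it squares to 1 only on ψ,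
  -- which is enough.
  have hCC : C (C ψ) = ψ := by
    rw [hC, ← mul_apply_eq_comp, cA', mul_apply_eq_comp, hC, ← mul_apply_eq_comp, hA']; rfl
  have hDD : (1 - C) ((1 - C) ψ) = (2 : ℂ) • (1 - C) ψ := by
    simp only [sub_apply, one_apply_eq_self, map_sub, hCC]; module
  have hD : (1 - A') ψ = (1 - C) ψ := by simp [hC]
  have sGD : IsSelfAdjoint ((1 - A) * (1 - C)) := by
    rw [isSelfAdjoint_iff, star_mul, ((IsSelfAdjoint.one _).sub sA).star_eq,
      ((IsSelfAdjoint.one _).sub sC).star_eq, cGD]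
  have hsq : (((1 - A) * (1 - C)) * ((1 - A) * (1 - C))) ψ
      = (4 : ℂ) • ((1 - A) * (1 - C)) ψ := by
    have : ((1 - A) * (1 - C)) * ((1 - A) * (1 - C)) = (1 - A) * (1 - A) * ((1 - C) * (1 - C)) := by
      rw [mul_assoc, ← mul_assoc (1 - C), cGD]; simp only [mul_assoc]
    rw [this, hGG, mul_apply_eq_comp, mul_apply_eq_comp, hDD, map_smul, smul_apply, smul_smul,
      mul_apply_eq_comp]
    norm_num
  -- By `hsq` the squared norm of (1 - A)(1 - C)ψ is 4 times this expectation, so its vanishing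
  -- kills the vector.
  have he : inner ℂ ψ (((1 - A) * (1 - C)) ψ) = 0 := by
    have : ((1 - A) * (1 - C)) ψ = ψ - C ψ - A ψ + (A * C) ψ := by
      simp only [mul_sub, sub_mul, mul_one, one_mul, sub_apply, one_apply_eq_self]; abel
    rw [this, inner_add_right, inner_sub_right, inner_sub_right, hψ', hC, eA, eA', e]
    push_cast; ring
  have hn := norm_sq_apply_of_isSelfAdjoint sGD ψ
  rw [hsq, inner_smul_right, he, mul_zero] at hn
  have hn' : ‖((1 - A) * (1 - C)) ψ‖ ^ 2 = 0 := by exact_mod_cast hn.symm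
  rw [hD, ← mul_apply_eq_comp]
  simpa using hn'

variable {H K : Type*} [NormedAddCommGroup H] [InnerProductSpace ℂ H]
  [NormedAddCommGroup K] [InnerProductSpace ℂ K]

/-- The orbit of a vector under Bob's operators. -/
def bobOrbit (ψ : HTensor H K) : Submodule ℂ (HTensor H K) :=
  LinearMap.range
    ({ toFun := fun T : K →L[ℂ] K => opTensor 1 T ψ
       map_add' := fun T T' => by rw [opTensor_add_right, add_apply]
       map_smul' := fun c T => by rw [opTensor_smul_right]; rfl } :
      (K →L[ℂ] K) →ₗ[ℂ] HTensor H K)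

theorem mem_bobOrbit {ψ x : HTensor H K} : x ∈ bobOrbit ψ ↔ ∃ T : K →L[ℂ] K, opTensor 1 T ψ = x :=
  Iff.rfl

theorem self_mem_bobOrbit (ψ : HTensor H K) : ψ ∈ bobOrbit ψ :=
  ⟨1, by change opTensor 1 1 ψ = ψ; rw [opTensor_one_one]; rfl⟩

instance finiteDimensional_bobOrbit [FiniteDimensional ℂ K] (ψ : HTensor H K) :
    FiniteDimensional ℂ (bobOrbit ψ) := by
  rw [bobOrbit]
  infer_instance

/-- The projection onto the `-1` eigenspace of Alice's observable `S`. -/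
def minusProj (K : Type*) [NormedAddCommGroup K] [InnerProductSpace ℂ K] (S : H →L[ℂ] H) :
    HTensor H K →ₗ[ℂ] HTensor H K :=
  ((1 / 2 : ℂ) • (1 - opTensor S (1 : K →L[ℂ] K)) : HTensor H K →L[ℂ] HTensor H K)

theorem minusProj_apply (S : H →L[ℂ] H) (x : HTensor H K) :
    minusProj K S x = (1 / 2 : ℂ) • (x - opTensor S 1 x) := rfl

theorem minusProj_minusProj {S : H →L[ℂ] H} (hS : S * S = 1) (x : HTensor H K) :
    minusProj K S (minusProj K S x) = minusProj K S x := by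
  simp only [minusProj_apply, map_smul, map_sub, opTensor_one_apply_self hS]
  module

/-- Alice's `S` commutes past Bob's `R` to reach ψ, where it can be replaced by Bob's `T`. -/
theorem minusProj_mem_bobOrbit {S : H →L[ℂ] H} {ψ : HTensor H K} {T : K →L[ℂ] K}
    (h : opTensor 1 T ψ = opTensor S 1 ψ) {u : HTensor H K} (hu : u ∈ bobOrbit ψ) :
    minusProj K S u ∈ bobOrbit ψ := by
  obtain ⟨R, rfl⟩ := mem_bobOrbit.1 hu
  rw [minusProj_apply]
  refine Submodule.smul_mem _ _ (Submodule.sub_mem _ hu (mem_bobOrbit.2 ⟨R * T, ?_⟩))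
  rw [opTensor_one_apply_comm, ← h, ← mul_apply_eq_comp, opTensor_mul, one_mul]

theorem finrank_bobOrbit_le [FiniteDimensional ℂ K] {S S' : H →L[ℂ] H} {ψ : HTensor H K}
    {M : K →L[ℂ] K} {c : ℂ} (hc : c ≠ 0) (hS' : S' * S' = 1)
    (h : opTensor 1 M (ψ - opTensor S 1 ψ) = c • opTensor S' 1 (ψ + opTensor S 1 ψ)) :
    Module.finrank ℂ (bobOrbit ψ)
      ≤ 2 * Module.finrank ℂ ((bobOrbit ψ).map (minusProj K S)) := by
  have hinj : Function.Injective (opTensor S' (1 : K →L[ℂ] K)) :=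
    Function.LeftInverse.injective (g := opTensor S' (1 : K →L[ℂ] K)) (opTensor_one_apply_self hS')
  refine finrank_le_two_mul_finrank_map _ _
    (opTensor S' (1 : K →L[ℂ] K) : HTensor H K →ₗ[ℂ] HTensor H K) hinj ?_
  intro u hu
  obtain ⟨R, rfl⟩ := mem_bobOrbit.1 hu
  -- Writing Π for `minusProj K S`: S'(1 - Π)Rψ = ½ R S'(1 + S)ψ = ½ c⁻¹ R M (1 - S)ψ = Π(c⁻¹ R M
  -- ψ), by `h`.
  refine ⟨c⁻¹ • opTensor 1 (R * M) ψ, Submodule.smul_mem _ _ (mem_bobOrbit.2 ⟨_, rfl⟩), ?_⟩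
  have e1 : opTensor 1 (R * M) ψ - opTensor S 1 (opTensor 1 (R * M) ψ)
      = c • opTensor 1 R (opTensor S' 1 (ψ + opTensor S 1 ψ)) := by
    have : opTensor (1 : H →L[ℂ] H) (R * M) = opTensor 1 R * opTensor 1 M := by
      rw [opTensor_mul, one_mul]
    rw [opTensor_one_apply_comm, ← map_sub, this, mul_apply_eq_comp, h, map_smul]
  have e2 : opTensor 1 R ψ - minusProj K S (opTensor 1 R ψ)
      = (1 / 2 : ℂ) • opTensor 1 R (ψ + opTensor S 1 ψ) := by
    rw [minusProj_apply, opTensor_one_apply_comm, map_add]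
    module
  rw [e2, map_smul, minusProj_apply, e1, map_smul, smul_comm c⁻¹, smul_smul c⁻¹,
    inv_mul_cancel₀ hc, one_smul]
  exact congrArg _ (opTensor_one_apply_comm _ _ _).symm

/-- Alice's projections commute with Bob's operators, so a relation at ψ spreads to the whole orbit.
-/
theorem minusProj_minusProj_of_mem_bobOrbit {S S' : H →L[ℂ] H} {ψ : HTensor H K}
    (h : minusProj K S (minusProj K S' ψ) = 0) {u : HTensor H K} (hu : u ∈ bobOrbit ψ) :
    minusProj K S (minusProj K S' u) = 0 := by
  obtain ⟨R, rfl⟩ := mem_bobOrbit.1 hu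
  have hcomm (S : H →L[ℂ] H) (x : HTensor H K) :
      minusProj K S (opTensor 1 R x) = opTensor 1 R (minusProj K S x) := by
    rw [minusProj_apply, minusProj_apply, opTensor_one_apply_comm, map_smul, map_sub]
  rw [hcomm, hcomm, h, map_zero]

variable [CompleteSpace H] [CompleteSpace K]

theorem inner_minusProj {S : H →L[ℂ] H} (hS : IsSelfAdjoint S) (x y : HTensor H K) :
    inner ℂ (minusProj K S x) y = inner ℂ x (minusProj K S y) := by
  have : inner ℂ (opTensor S 1 x) y = inner ℂ x (opTensor S 1 y) :=
    ContinuousLinearMap.isSelfAdjoint_iff_isSymmetric.1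
      (isSelfAdjoint_opTensor_one (K := K) hS) x y
  rw [minusProj_apply, minusProj_apply, inner_smul_left, inner_smul_right, inner_sub_left,
    inner_sub_right, this]
  congr 1
  rw [map_div₀, map_one, map_ofNat]

/-- No strategy with a finite-dimensional space for Bob generates the correlation. -/
theorem not_generates_of_finiteDimensional [FiniteDimensional ℂ K] {α : ℝ} (h0 : 0 < α)
    (h1 : α < 1) {ψ : HTensor H K} {P : Fin 4 → Fin 2 → H →L[ℂ] H}
    {Q : Fin 4 → Fin 2 → K →L[ℂ] K} : ¬ Generates ψ P Q (corr α) := by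
  intro h
  have hk := cosTwoTheta_pos h0 h1
  have hk1 := cosTwoTheta_lt_one h0
  have hc := cos_mu_pos α
  obtain ⟨ra, rb⟩ := h.rigidity_zero_one h0 h1
  obtain ⟨ra', rb'⟩ := h.rigidity_two_three h0 h1
  have hA (s : Fin 4) := (h.2.1 s).observable_mul_self
  have sA (s : Fin 4) := (h.2.1 s).isSelfAdjoint_observable
  have sB (t : Fin 4) := (h.2.2.1 t).isSelfAdjoint_observable
  have ne1 : ((2 * Real.cos (mu α) : ℝ) : ℂ) ≠ 0 := by
    exact_mod_cast (by positivity : (2 * Real.cos (mu α) : ℝ) ≠ 0)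
  have ne2 : ((2 * Real.cos (mu α) * (1 - cosTwoTheta α) : ℝ) : ℂ) ≠ 0 := by
    have : 0 < 1 - cosTwoTheta α := by linarith
    exact_mod_cast (by positivity : (2 * Real.cos (mu α) * (1 - cosTwoTheta α) : ℝ) ≠ 0)
  have bob {T : K →L[ℂ] K} {S : H →L[ℂ] H} {c : ℂ} (hc : c ≠ 0)
      (hT : opTensor 1 T ψ = c • opTensor S 1 ψ) : opTensor 1 (c⁻¹ • T) ψ = opTensor S 1 ψ := by
    rw [opTensor_smul_right, smul_apply, hT, smul_smul, inv_mul_cancel₀ hc, one_smul]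
  -- Bob's counterpart of `observable (P 2)` on ψ; it makes the product of Alice's two possibly
  -- noncommuting observables accessible to the correlation.
  have sC : IsSelfAdjoint (((2 * Real.cos (mu α) : ℝ) : ℂ)⁻¹ •
      (observable (Q 2) + observable (Q 3))) := by
    refine IsSelfAdjoint.smul ?_ ((sB 2).add (sB 3))
    rw [← Complex.ofReal_inv, isSelfAdjoint_iff]
    exact Complex.conj_ofReal _
  have hann : minusProj K (observable (P 0)) (minusProj K (observable (P 2)) ψ) = 0 := by
    have key := sub_apply_sub_apply_eq_zero h.1 (isSelfAdjoint_opTensor_one (K := K) (sA 0))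
      (isSelfAdjoint_one_opTensor (H := H) sC)
      (A' := opTensor (observable (P 2)) 1)
      (by rw [opTensor_mul, hA, one_mul, opTensor_one_one])
      (by rw [opTensor_mul, hA, one_mul, opTensor_one_one])
      (one_opTensor_mul_opTensor_one _ _) (one_opTensor_mul_opTensor_one _ _) (bob ne1 ra')
      (h.inner_left_zero h0 h1) (h.inner_left_two h0 h1)
      (by
        rw [opTensor_one_mul_one, opTensor_smul_right, smul_apply, inner_smul_right,
          h.inner_cross h0 h1, Complex.ofReal_mul (2 * Real.cos (mu α)), ← mul_assoc,
          inv_mul_cancel₀ ne1, one_mul])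
    have key' : (ψ - opTensor (observable (P 2)) 1 ψ)
        - opTensor (observable (P 0)) 1 (ψ - opTensor (observable (P 2)) 1 ψ) = 0 := key
    rw [minusProj_apply, minusProj_apply, map_smul, ← smul_sub, key', smul_zero, smul_zero]
  have hann' : minusProj K (observable (P 2)) (minusProj K (observable (P 0)) ψ) = 0 := by
    -- ‖Π_2 Π_0 ψ‖² = ⟨ψ, Π_0 Π_2 Π_0 ψ⟩, which vanishes because Π_0 ψ lies in the orbit, where Π_0
    -- Π_2 = 0.
    rw [← inner_self_eq_zero (𝕜 := ℂ), inner_minusProj (sA 2), inner_minusProj (sA 0),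
      minusProj_minusProj (hA 2), minusProj_minusProj_of_mem_bobOrbit hann
        (minusProj_mem_bobOrbit (bob ne1 ra) (self_mem_bobOrbit ψ)), inner_zero_right]
  have hsum := add_apply_eq_self_of_finrank_le (bobOrbit ψ) (minusProj K (observable (P 0)))
    (minusProj K (observable (P 2)))
    (fun _ hu => minusProj_mem_bobOrbit (bob ne1 ra) hu)
    (fun _ hu => minusProj_mem_bobOrbit (bob ne1 ra') hu)
    (minusProj_minusProj (hA 0)) (minusProj_minusProj (hA 2))
    (fun _ hu => minusProj_minusProj_of_mem_bobOrbit hann hu)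
    (fun _ hu => minusProj_minusProj_of_mem_bobOrbit hann' hu)
    (finrank_bobOrbit_le ne2 (hA 1) rb) (finrank_bobOrbit_le ne2 (hA 3) rb')
    ψ (self_mem_bobOrbit ψ)
  have hψ' : inner ℂ ψ ψ = (1 : ℂ) := by rw [inner_self_eq_norm_sq_to_K, h.1]; simp
  -- Each projection has expectation (1 - k)/2, so a sum equal to 1 forces k = 0.
  have hfin := congrArg (inner ℂ ψ) hsum
  rw [minusProj_apply, minusProj_apply, inner_add_right, inner_smul_right, inner_smul_right,
    inner_sub_right, inner_sub_right, h.inner_left_zero h0 h1, h.inner_left_two h0 h1, hψ'] at hfin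
  have : (cosTwoTheta α : ℂ) = 0 := by linear_combination -hfin
  exact hk.ne' (by exact_mod_cast this)

theorem corr_notMem_Cq {α : ℝ} (h0 : 0 < α) (h1 : α < 1) : corr α ∉ Cq 4 4 2 2 := by
  rintro ⟨HA, _, _, _, _, HB, _, _, _, _, ψ, P, Q, h⟩
  exact not_generates_of_finiteDimensional h0 h1 h

end Contradiction

end QCorr

end

theorem theorem5 :
    (∀ α : ℝ, 0 < α → α < 1 →
      QCorr.Generates (QCorr.Psi α) (fun s a => QCorr.outcomeProj (QCorr.obsA s) a)
          (fun t b => QCorr.outcomeProj (QCorr.obsB α t) b) (QCorr.corr α) ∧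
        QCorr.corr α ∈ QCorr.Cqs 4 4 2 2 ∧ QCorr.corr α ∉ QCorr.Cq 4 4 2 2) ∧
      QCorr.Cq 4 4 2 2 ≠ QCorr.Cqs 4 4 2 2 := by
  refine ⟨fun α h0 h1 => ⟨QCorr.generates_corr h0 h1, QCorr.corr_mem_Cqs h0 h1,
    QCorr.corr_notMem_Cq h0 h1⟩, fun h => ?_⟩
  have h0 : (0 : ℝ) < 1 / 2 := by norm_num
  have h1 : (1 / 2 : ℝ) < 1 := by norm_num
  exact QCorr.corr_notMem_Cq h0 h1 (h ▸ QCorr.corr_mem_Cqs h0 h1)
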